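/- All graphs are finite and simple. For a graph $F$, a graph $G$ is *uniquely $F$-saturated* if $G$ contains no subgraph isomorphic to $F$ and, for every two distinct non-adjacent vertices $x,y$ of $G$, the graph $G+xy$ obtained by adding the edge $xy$ contains exactly one subgraph isomorphic to $F$. Let $C_t$ denote the cycle with $t$ vertices. Theorem. For every integer $t\ge 6$ there are, up to isomorphism, only finitely many uniquely $C_t$-saturated graphs. -/

import Mathlib

namespace SimpleGraph

/-- `G` is `F`-saturated: `F` is not a subgraph of `G` (up to isomorphism), but `F` is a subgraph
of `G + xy` for every edge `xy` of the complement of `G`. -/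
def IsSaturated {W V : Type*} (F : SimpleGraph W) (G : SimpleGraph V) : Prop :=
  ¬ F.IsContained G ∧ ∀ x y : V, Gᶜ.Adj x y → F.IsContained (G ⊔ edge x y)

/-- `G` is uniquely `F`-saturated: `G` is `F`-saturated, and for every edge `xy` of the complement
of `G` there is exactly one copy of `F` in `G + xy`. A copy of `F` is a subgraph isomorphic to `F`
(so copies are not labelled). -/
def IsUniquelySaturated {W V : Type*} (F : SimpleGraph W) (G : SimpleGraph V) : Prop :=
  F.IsSaturated G ∧
    ∀ x y : V, Gᶜ.Adj x y → ∃! H : (G ⊔ edge x y).Subgraph, Nonempty (F ≃g H.coe)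

end SimpleGraph

namespace SimpleGraph

/-! Put `k = t - 1 ≥ 5`. Closing a path with the missing edge turns unique saturation into
`HasUniquePaths`. A complete graph on at least `t` vertices contains the cycle, so it suffices to
bound the order of the non-complete graphs with unique `k`-paths.

Such a graph has an even cycle of length at most `2k` (`not_evenCycleFree`). Without one, an edge
lies on at most one short odd cycle (`eq_of_even_length`), and then the `k`-paths required between
the ends of two-edge paths (`k` even) or three-edge paths (`k` odd) have nowhere to run.

Let `T` be the vertex set of such a cycle. A path leaving it at `x` has fewer than `k` edges:
otherwise both arcs of the cycle from the antipode of `x` could be prolonged along it to `k`-paths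
with the same ends (`length_lt_of_isCycle`). So paths that avoid `T` and start next to `T` are
short. If the graph is huge, deleting boundedly many vertices then leaves many isomorphic components
attached in the same way (`exists_hasTwins_of_length_lt`).

Many such twins are impossible (`TwinFamily.false_of_hasUniquePaths`). Permuting the copies is an
automorphism, so a `k`-path avoids every copy that contains neither of its ends, and the `k`-path
between corresponding vertices is symmetric. This forces `k = 2r` and a single outside vertex `s`
adjacent to everything in the copies; moreover each vertex of a copy starts exactly one path on `r`
vertices. The chords that such a path must have yield a second one. -/

/-- Any two distinct non-adjacent vertices of `G` are joined by exactly one path of length `k`, and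
adjacent vertices are joined by none. -/
structure HasUniquePaths {V : Type*} (G : SimpleGraph V) (k : ℕ) : Prop where
  exists_path : ∀ x y : V, x ≠ y → ¬ G.Adj x y → ∃ p : G.Walk x y, p.IsPath ∧ p.length = k
  not_adj : ∀ (x y : V) (p : G.Walk x y), p.IsPath → p.length = k → ¬ G.Adj x y
  eq_of_isPath : ∀ (x y : V) (p q : G.Walk x y), p.IsPath → q.IsPath → p.length = k →
    q.length = k → p = q

/-! ### Unique saturation as uniqueness of paths -/

section Translation

variable {V : Type*} {G : SimpleGraph V} {k : ℕ}

lemma cycleGraph_isContained_of_isPath (hk : 2 ≤ k) {x y : V} {p : G.Walk x y} (hp : p.IsPath)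
    (hl : p.length = k) (h : G.Adj x y) : (cycleGraph (k + 1)).IsContained G := by
  rw [cycleGraph_isContained_iff (by omega)]
  refine ⟨x, p.append h.symm.toWalk, hp.isCycle_append (h.symm.isPath_toWalk) ?_ (by omega), by
    simp [hl]⟩
  have h1 := hp.support_nodup
  rw [← Walk.cons_tail_support, List.nodup_cons] at h1
  intro a ha ha'
  simp [Adj.toWalk] at ha'
  exact h1.1 (ha' ▸ ha)

/-- The copy of a cycle obtained by closing a path with the edge joining its ends. -/
def copyOfPath {x y : V} (p : G.Walk x y) (hp : p.IsPath) (hl : p.length = k) (hne : x ≠ y) :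
    Copy (cycleGraph (k + 1)) (G ⊔ edge x y) where
  toHom :=
    { toFun := fun i => p.getVert i
      map_rel' := by
        have key : ∀ i j : Fin (k + 1), (j - i).val = 1 →
            (G ⊔ edge x y).Adj (p.getVert i) (p.getVert j) := by
          intro i j hij
          rcases le_or_gt i j with h | h
          · rw [Fin.sub_val_of_le h] at hij
            have hj : (j : ℕ) = i + 1 := by have : (i : ℕ) ≤ j := h; omega
            rw [hj]
            exact Or.inl (p.adj_getVert_succ (by omega))
          · rw [Fin.coe_sub_iff_lt.mpr h] at hij
            have hi : (i : ℕ) = k := by have := i.2; omega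
            have hj : (j : ℕ) = 0 := by have := i.2; omega
            refine Or.inr ?_
            rw [hi, hj, edge_adj, ← hl, Walk.getVert_length, Walk.getVert_zero]
            exact ⟨Or.inr ⟨rfl, rfl⟩, hne.symm⟩
        intro i j hij
        rcases cycleGraph_adj'.mp hij with h | h
        · exact (key j i h).symm
        · exact key i j h }
  injective' := by
    intro i j hij
    exact Fin.ext (hp.getVert_injOn (by have := i.2; simp; omega) (by have := j.2; simp; omega) hij)

/-- Both paths start at `x`, and the cycle leaves no choice afterwards: going back repeats a vertex,
and using the closing edge reaches `y` too early. -/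
lemma eq_of_toSubgraph_copyOfPath_eq (hk : 2 ≤ k) {x y : V} {p q : G.Walk x y} (hp : p.IsPath)
    (hq : q.IsPath) (hpl : p.length = k) (hql : q.length = k) (hne : x ≠ y)
    (h : (copyOfPath p hp hpl hne).toSubgraph = (copyOfPath q hq hql hne).toSubgraph) : p = q := by
  have key : ∀ i, i ≤ k → q.getVert i = p.getVert i := by
    intro i
    induction i using Nat.strong_induction_on with
    | _ i ih =>
      intro hi
      rcases i with _ | i
      · simp
      have hadj : (copyOfPath q hq hql hne).toSubgraph.Adj (q.getVert i) (q.getVert (i + 1)) := by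
        rw [Subgraph.map_adj]
        refine ⟨⟨i, by omega⟩, ⟨i + 1, by omega⟩, ?_, rfl, rfl⟩
        simp only [Subgraph.top_adj]
        rw [cycleGraph_adj']
        right
        rw [Fin.sub_val_of_le (by simp [Fin.le_def])]
        simp
      rw [← h, Subgraph.map_adj] at hadj
      obtain ⟨a, b, hab, ha, hb⟩ := hadj
      simp only [Subgraph.top_adj] at hab
      change p.getVert a = q.getVert i at ha
      change p.getVert b = q.getVert (i + 1) at hb
      have ha2 := a.2
      have hb2 := b.2
      rw [ih i (by omega) (by omega)] at ha
      have hai : (a : ℕ) = i := hp.getVert_injOn (by simp; omega) (by simp; omega) ha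
      rw [cycleGraph_adj'] at hab
      -- The last alternative is the closing edge, which joins the indices `0` and `k`.
      have hb' : (b : ℕ) = i + 1 ∨ (b : ℕ) + 1 = i ∨ ((b : ℕ) = k ∧ i = 0) := by
        rcases hab with h1 | h1
        · rcases le_or_gt b a with h2 | h2
          · rw [Fin.sub_val_of_le h2] at h1; omega
          · rw [Fin.coe_sub_iff_lt.mpr h2] at h1
            have : (a : ℕ) < b := h2
            omega
        · rcases le_or_gt a b with h2 | h2
          · rw [Fin.sub_val_of_le h2] at h1; omega
          · rw [Fin.coe_sub_iff_lt.mpr h2] at h1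
            have : (b : ℕ) < a := h2
            omega
      rcases hb' with h1 | h1 | ⟨h1, h2⟩
      · rw [← h1, hb, h1]
      · rw [← ih b (by omega) (by omega)] at hb
        have := hq.getVert_injOn (by simp; omega) (by simp; omega) hb
        omega
      · have h3 : p.getVert b = q.getVert k := by
          rw [h1]
          conv_lhs => rw [← hpl]
          rw [← hql, Walk.getVert_length, Walk.getVert_length]
        rw [h3] at hb
        have := hq.getVert_injOn (by simp; omega) (by simp; omega) hb
        omega
  refine Walk.ext_getVert_le_length (by omega) fun i hi => (key i (by omega)).symm

/-- The cycle has to use the new edge; rotated and oriented so that this edge comes first, it leaves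
the path as its tail. -/
lemma exists_isPath_of_isContained_sup_edge {x y : V} (hk : 2 ≤ k)
    (hG : ¬ (cycleGraph (k + 1)).IsContained G)
    (h : (cycleGraph (k + 1)).IsContained (G ⊔ edge x y)) :
    ∃ p : G.Walk x y, p.IsPath ∧ p.length = k := by
  classical
  obtain ⟨v, c, hc, hcl⟩ := (cycleGraph_isContained_iff (by omega)).mp h
  have hmem : s(x, y) ∈ c.edges := by
    by_contra hmem
    have hE : ∀ e ∈ c.edges, e ∈ G.edgeSet := by
      intro e he
      have h1 := c.edges_subset_edgeSet he
      induction e with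
      | _ a b =>
        rw [mem_edgeSet, sup_adj, edge_adj] at h1
        rcases h1 with h1 | ⟨⟨rfl, rfl⟩ | ⟨rfl, rfl⟩, -⟩
        · exact h1
        · exact absurd he hmem
        · exact absurd (Sym2.eq_swap ▸ he) hmem
    exact hG ((cycleGraph_isContained_iff (by omega)).mpr
      ⟨v, c.transfer G hE, hc.transfer hE, by simpa using hcl⟩)
  have key : ∃ (hxy : (G ⊔ edge x y).Adj y x) (p : (G ⊔ edge x y).Walk x y),
      (Walk.cons hxy p).IsCycle ∧ p.length = k := by
    have hy : y ∈ c.support := c.snd_mem_support_of_mem_edges hmem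
    have hc' := hc.rotate hy
    have hl' : (c.rotate y hy).length = k + 1 := by rw [Walk.length_rotate, hcl]
    have hm' : s(y, x) ∈ (c.rotate y hy).edges := by
      rw [Sym2.eq_swap]
      exact (c.rotate_edges y hy).perm.mem_iff.mpr hmem
    generalize c.rotate y hy = d at hc' hl' hm'
    clear hc hcl hmem hy
    have aux : ∀ d : (G ⊔ edge x y).Walk y y, d.IsCycle → d.length = k + 1 → d.snd = x →
        ∃ (hxy : (G ⊔ edge x y).Adj y x) (p : (G ⊔ edge x y).Walk x y),
          (Walk.cons hxy p).IsCycle ∧ p.length = k := by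
      intro d hd hdl hs
      cases d with
      | nil => simp at hdl
      | cons h p =>
        simp at hs
        subst hs
        exact ⟨h, p, hd, by simpa using hdl⟩
    -- Started at `y`, the cycle traverses the new edge either first or last; reversal reduces the
    -- second case to the first.
    by_cases hs : d.snd = x
    · exact aux d hc' hl' hs
    · refine aux d.reverse hc'.reverse (by simpa using hl') ?_
      cases d with
      | nil => simp at hl'
      | cons h p =>
        have hp := (Walk.cons_isCycle_iff p h).mp hc'
        simp at hs
        simp only [Walk.edges_cons, List.mem_cons] at hm'
        have h2 : s(y, x) ∈ p.edges := by
          rcases hm' with h1 | h1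
          · rw [Sym2.eq_iff] at h1
            rcases h1 with ⟨-, h1⟩ | ⟨h1, h3⟩
            · exact absurd h1.symm hs
            · exact absurd (h3.trans h1).symm hs
          · exact h1
        rw [Sym2.eq_swap] at h2
        have := hp.1.eq_penultimate_of_mem_edges (Sym2.eq_swap ▸ h2)
        rw [Walk.snd_reverse, Walk.penultimate_cons_of_not_nil, ← this]
        rintro hnil
        cases hnil
        simp at h2
  obtain ⟨hxy, p, hc', hl⟩ := key
  obtain ⟨hp, hn⟩ := (Walk.cons_isCycle_iff p hxy).mp hc'
  have hE : ∀ e ∈ p.edges, e ∈ G.edgeSet := by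
    intro e he
    have h1 := p.edges_subset_edgeSet he
    induction e with
    | _ a b =>
      rw [mem_edgeSet, sup_adj, edge_adj] at h1
      rcases h1 with h1 | ⟨⟨rfl, rfl⟩ | ⟨rfl, rfl⟩, -⟩
      · exact h1
      · exact absurd (Sym2.eq_swap ▸ he) hn
      · exact absurd he hn
  exact ⟨p.transfer G hE, hp.transfer hE, by simpa using hl⟩

lemma IsUniquelySaturated.hasUniquePaths (hk : 2 ≤ k)
    (h : (cycleGraph (k + 1)).IsUniquelySaturated G) : G.HasUniquePaths k where
  exists_path x y hne hadj :=
    exists_isPath_of_isContained_sup_edge hk h.1.1 (h.1.2 x y ((compl_adj G x y).mpr ⟨hne, hadj⟩))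
  not_adj _ _ _ hp hl hadj := h.1.1 (cycleGraph_isContained_of_isPath hk hp hl hadj)
  eq_of_isPath x y p q hp hq hpl hql := by
    have hne : x ≠ y := by
      rintro rfl
      have := Walk.length_eq_zero_iff.mpr (Walk.isPath_iff_nil.mp hp)
      omega
    have hadj : ¬ G.Adj x y := fun hadj =>
      h.1.1 (cycleGraph_isContained_of_isPath hk hp hpl hadj)
    exact eq_of_toSubgraph_copyOfPath_eq hk hp hq hpl hql hne
      ((h.2 x y ((compl_adj G x y).mpr ⟨hne, hadj⟩)).unique
        ⟨(copyOfPath p hp hpl hne).isoToSubgraph⟩ ⟨(copyOfPath q hq hql hne).isoToSubgraph⟩)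

end Translation

end SimpleGraph

/-! ### Graphs without short even cycles -/

namespace SimpleGraph

section Walks

variable {V : Type*} {G : SimpleGraph V} {u v w : V}

lemma Walk.isPath_append_iff {p : G.Walk u v} {q : G.Walk v w} :
    (p.append q).IsPath ↔ p.IsPath ∧ q.IsPath ∧ ∀ z ∈ p.support, z ∈ q.support → z = v := by
  refine ⟨fun h => ⟨h.of_append_left, h.of_append_right, fun z hz hz' => ?_⟩, fun ⟨hp, hq, h⟩ => ?_⟩
  · by_contra hne
    exact h.ne_of_mem_support_of_append hne hz hz' rfl
  · rw [Walk.isPath_def, Walk.support_append, List.nodup_append']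
    refine ⟨hp.support_nodup, hq.support_nodup.tail, fun z hz hz' => ?_⟩
    have h1 := h z hz (List.mem_of_mem_tail hz')
    subst h1
    have h2 := hq.support_nodup
    rw [← Walk.cons_tail_support, List.nodup_cons] at h2
    exact h2.1 hz'

lemma Walk.exists_eq_append_of_end_mem (p : G.Walk u v) (S : Set V) (hv : v ∈ S) :
    ∃ (d : V) (q : G.Walk u d) (r : G.Walk d v), p = q.append r ∧ d ∈ S ∧
      ∀ z ∈ q.support, z ∈ S → z = d := by
  induction p with
  | nil => exact ⟨_, .nil, .nil, rfl, hv, by simp⟩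
  | @cons a b c h p ih =>
    by_cases ha : a ∈ S
    · exact ⟨a, .nil, .cons h p, rfl, ha, by simp⟩
    · obtain ⟨d, q, r, rfl, hd, hq⟩ := ih hv
      refine ⟨d, .cons h q, r, rfl, hd, ?_⟩
      intro z hz hzS
      rw [Walk.support_cons, List.mem_cons] at hz
      rcases hz with rfl | hz
      · exact absurd hzS ha
      · exact hq z hz hzS

end Walks

/-- All even cycles of `G` are longer than `n`. -/
def EvenCycleFree {V : Type*} (G : SimpleGraph V) (n : ℕ) : Prop :=
  ∀ (v : V) (c : G.Walk v v), c.IsCycle → Even c.length → n < c.length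

lemma isCycle_append_reverse {V : Type*} {G : SimpleGraph V} {u w : V}
    {p q : G.Walk u w} (hp : p.IsPath) (hq : q.IsPath)
    (hd : ∀ z ∈ p.support, z ∈ q.support → z = u ∨ z = w)
    (hl : 1 < p.length ∨ 1 < q.length) : (p.append q.reverse).IsCycle := by
  refine hp.isCycle_append hq.reverse ?_ (by simpa using hl)
  intro z hz hz'
  have hq' := hq.reverse.support_nodup
  have hp' := hp.support_nodup
  rw [← Walk.cons_tail_support, List.nodup_cons] at hp' hq'
  have h2 : z ∈ q.support := by simpa using List.mem_of_mem_tail hz'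
  rcases hd z (List.mem_of_mem_tail hz) h2 with rfl | rfl
  · exact hp'.1 hz
  · exact hq'.1 hz'

namespace EvenCycleFree

variable {V : Type*} {G : SimpleGraph V} {n : ℕ}

lemma not_even_add (hG : G.EvenCycleFree n) {u w : V} {p q : G.Walk u w} (hp : p.IsPath)
    (hq : q.IsPath) (hd : ∀ z ∈ p.support, z ∈ q.support → z = u ∨ z = w)
    (hl : 1 < p.length ∨ 1 < q.length) (hn : p.length + q.length ≤ n)
    (he : Even (p.length + q.length)) : False := by
  have := hG u _ (isCycle_append_reverse hp hq hd hl) (by simpa using he)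
  simp at this
  omega

/-- A common first edge of `p` and `q` is moved to `α`, which preserves the length bound and the
parity conditions. Once the first edges differ, `q` meets `p` again at some `d`, and the three
internally disjoint paths from `c` to `d` (along `p`, along `q`, and along `α` and back on `p`)
contain an even cycle. -/
lemma eq_of_isPath_aux (hG : G.EvenCycleFree n) {b : V} {c : V} (p : G.Walk c b) :
    ∀ (q : G.Walk c b) (α : G.Walk c b), p.IsPath → q.IsPath → α.IsPath → 1 ≤ α.length →
    (∀ z ∈ α.support, z ∈ p.support → z = c ∨ z = b) →
    (∀ z ∈ α.support, z ∈ q.support → z = c ∨ z = b) →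
    p.length % 2 = q.length % 2 → (p.length + α.length) % 2 = 1 →
    p.length + q.length + 2 * α.length ≤ n + 2 → p = q := by
  induction p with
  | nil =>
    intro q α _ hq
    intros
    exact (Walk.length_eq_zero_iff.mp (Walk.length_eq_zero_iff.mpr
      (Walk.isPath_iff_nil.mp hq))).eq_nil.symm
  | @cons c c₁ b h p ih =>
    intro q α hp hq hα hα1 hαp hαq hpq hpα hn
    cases q with
    | nil => exact absurd (Walk.isPath_iff_nil.mp hp) (by simp)
    | @cons _ d₁ _ h' q =>
      rw [Walk.cons_isPath_iff] at hp hq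
      simp only [Walk.length_cons] at hpq hpα hn
      have hcb : c ≠ b := by rintro rfl; exact hp.2 p.end_mem_support
      by_cases hcd : c₁ = d₁
      · subst hcd
        congr 1
        by_cases hc1 : c₁ = b
        · subst hc1
          rw [(Walk.isPath_iff_nil.mp hp.1).eq_nil, (Walk.isPath_iff_nil.mp hq.1).eq_nil]
        have hcα : c₁ ∉ α.support := fun hmem => by
          rcases hαp c₁ hmem (by simp) with h1 | h1
          · exact h.ne h1.symm
          · exact hc1 h1
        refine ih q (.cons h.symm α) hp.1 hq.1 (hα.cons hcα) (by simp) ?_ ?_ (by omega)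
          (by simp; omega) (by simp; omega)
        · intro z hz hz'
          rw [Walk.support_cons, List.mem_cons] at hz
          rcases hz with hz | hz
          · exact Or.inl hz
          · rcases hαp z hz (by simp [hz']) with rfl | h1
            · exact absurd hz' hp.2
            · exact Or.inr h1
        · intro z hz hz'
          rw [Walk.support_cons, List.mem_cons] at hz
          rcases hz with hz | hz
          · exact Or.inl hz
          · rcases hαq z hz (by simp [hz']) with rfl | h1
            · exact absurd hz' hq.2
            · exact Or.inr h1
      · exfalso
        obtain ⟨d, q₁, q₂, rfl, hd, hq₁⟩ :=
          q.exists_eq_append_of_end_mem {z | z ∈ p.support} p.end_mem_support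
        obtain ⟨p₁, p₂, rfl⟩ := p.mem_support_iff_exists_append.mp hd
        have hpa := Walk.isPath_append_iff.mp hp.1
        have hqa := Walk.isPath_append_iff.mp hq.1
        have hp₁ : (Walk.cons h p₁).IsPath := hpa.1.cons fun hmem =>
          hp.2 (Walk.mem_support_append_iff _ _ |>.mpr (Or.inl hmem))
        have hq₁' : (Walk.cons h' q₁).IsPath := hqa.1.cons fun hmem =>
          hq.2 (Walk.mem_support_append_iff _ _ |>.mpr (Or.inl hmem))
        simp only [Walk.length_append] at hpq hpα hn
        -- If the cycle formed by the two initial segments is odd, exchanging the segment of `p` for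
        -- `α` and the rest of `p` changes the parity, since `p` and `α` close to an odd cycle.
        by_cases hpar : (p₁.length + q₁.length) % 2 = 0
        · refine hG.not_even_add hp₁ hq₁' ?_ ?_ (by simp; omega)
            (by rw [Nat.even_iff]; simp; omega)
          · intro z hz hz'
            rw [Walk.support_cons, List.mem_cons] at hz hz'
            rcases hz with hz | hz
            · exact Or.inl hz
            rcases hz' with hz' | hz'
            · exact Or.inl hz'
            · exact Or.inr (hq₁ z hz' (by simp [hz]))
          · by_contra hcon
            simp at hcon
            obtain ⟨h1, h2⟩ := hcon
            exact hcd (h1.eq.trans h2.eq.symm)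
        · have hαp₂ : (α.append p₂.reverse).IsPath := by
            refine Walk.isPath_append_iff.mpr ⟨hα, hpa.2.1.reverse, fun z hz hz' => ?_⟩
            have hz2 : z ∈ p₂.support := by simpa using hz'
            rcases hαp z hz (by simp [hz2]) with rfl | h1
            · exact absurd (by simp [hz2]) hp.2
            · exact h1
          refine hG.not_even_add hq₁' hαp₂ ?_ ?_ (by simp; omega)
            (by rw [Nat.even_iff]; simp; omega)
          · intro z hz hz'
            rw [Walk.support_cons, List.mem_cons] at hz
            rcases hz with hz | hz
            · exact Or.inl hz
            rw [Walk.mem_support_append_iff] at hz'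
            rcases hz' with hz' | hz'
            · rcases hαq z hz' (by simp [hz]) with h1 | h1
              · exact Or.inl h1
              · exact Or.inr (hq₁ z hz (by subst h1; simp))
            · have hz2 : z ∈ p₂.support := by simpa using hz'
              exact Or.inr (hq₁ z hz (by simp [hz2]))
          · simp only [Walk.length_cons, Walk.length_append, Walk.length_reverse]
            by_contra hcon
            have h1 : p₂.length = 0 := by omega
            have h2 : d = _ := (Walk.length_eq_zero_iff.mp h1).eq
            subst h2
            have h3 := Walk.length_eq_zero_iff.mpr (Walk.isPath_iff_nil.mp hqa.2.1)
            omega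

/-- In a graph without short even cycles, an edge lies on at most one short odd cycle. -/
lemma eq_of_even_length (hG : G.EvenCycleFree n) {a b : V} (h : G.Adj a b) {p q : G.Walk a b}
    (hp : p.IsPath) (hq : q.IsPath) (hpe : Even p.length) (hqe : Even q.length)
    (hn : p.length + q.length ≤ n) : p = q := by
  rw [Nat.even_iff] at hpe hqe
  -- Here `α` is the edge itself, which accounts for the `n + 2` in the auxiliary bound.
  refine hG.eq_of_isPath_aux p q h.toWalk hp hq h.isPath_toWalk (by simp) ?_ ?_ (by omega)
    (by simp; omega) (by simp; omega)
  all_goals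
    intro z hz _
    simpa [Adj.toWalk] using hz

lemma even_or_eq_one (hG : G.EvenCycleFree n) {a b : V} (h : G.Adj a b) {p : G.Walk a b}
    (hp : p.IsPath) (hn : p.length + 1 ≤ n) : Even p.length ∨ p.length = 1 := by
  by_contra hcon
  rw [not_or, Nat.even_iff] at hcon
  refine hG.not_even_add hp h.isPath_toWalk ?_ (by left; omega) (by simpa using hn)
    (by rw [Nat.even_iff]; simp; omega)
  intro z _ hz
  simpa [Adj.toWalk] using hz

end EvenCycleFree

end SimpleGraph

/-! ### Existence of a short even cycle -/

namespace SimpleGraph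

namespace HasUniquePaths

variable {V : Type*} {G : SimpleGraph V} {k : ℕ}

section EvenLength

/-- A `k`-path avoiding `m` would close up with `x m y` to an even cycle of length `k + 2`. Each of
the two pieces at `m` is even or a single edge; parity and `k ≥ 4` leave only two even pieces. -/
lemma exists_even_split (hU : G.HasUniquePaths k) (hG : G.EvenCycleFree (2 * k)) (hk : 4 ≤ k)
    (hke : Even k) {x m y : V} (hxm : G.Adj x m) (hmy : G.Adj m y) (hne : x ≠ y)
    (hxy : ¬ G.Adj x y) :
    ∃ (p : G.Walk x m) (q : G.Walk m y), (p.append q).IsPath ∧ p.length + q.length = k ∧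
      Even p.length ∧ Even q.length := by
  obtain ⟨P, hP, hl⟩ := hU.exists_path x y hne hxy
  rw [Nat.even_iff] at hke
  by_cases hm : m ∈ P.support
  · obtain ⟨p, q, rfl⟩ := P.mem_support_iff_exists_append.mp hm
    have hpq := Walk.isPath_append_iff.mp hP
    rw [Walk.length_append] at hl
    refine ⟨p, q, hP, hl, ?_⟩
    rcases hG.even_or_eq_one hxm hpq.1 (by omega) with h1 | h1 <;>
    rcases hG.even_or_eq_one hmy hpq.2.1 (by omega) with h2 | h2 <;>
    simp only [Nat.even_iff] at * <;> omega
  · exfalso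
    have hpath : (Walk.cons hxm hmy.toWalk).IsPath :=
      hmy.isPath_toWalk.cons (by simp [Adj.toWalk, hxm.ne, hne])
    refine hG.not_even_add hP hpath ?_ (by simp) (by simp; omega)
      (by rw [Nat.even_iff]; simp; omega)
    intro z hz hz'
    simp [Adj.toWalk] at hz'
    rcases hz' with h | rfl | h
    · exact Or.inl h
    · exact absurd hz hm
    · exact Or.inr h

/-- Let `e` follow `x` on `q`. If `e` is adjacent to `m`, then `xm` lies on a triangle and on a
longer odd cycle. If not, splitting the `k`-path for `e x m` gives an even path from `x` to `m`,
which must be `q`; but `q` contains the starting vertex `e` again. -/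
lemma false_of_four_le (hU : G.HasUniquePaths k) (hG : G.EvenCycleFree (2 * k)) (hk : 4 ≤ k)
    (hke : Even k) {x m : V} (hxm : G.Adj x m) (q : G.Walk x m) (hq : q.IsPath)
    (hqe : Even q.length) (hq4 : 4 ≤ q.length) (hqk : q.length + 2 ≤ k) : False := by
  cases q with
  | nil => simp at hq4
  | @cons _ e _ h q =>
    have hq' := (Walk.cons_isPath_iff h q).mp hq
    have hem : e ≠ m := by
      rintro rfl
      have := Walk.length_eq_zero_iff.mpr (Walk.isPath_iff_nil.mp hq'.1)
      simp at hq4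
      omega
    have hadj : ¬ G.Adj e m := by
      intro hadj
      have hpath : (Walk.cons h hadj.toWalk).IsPath :=
        hadj.isPath_toWalk.cons (by simp [Adj.toWalk, h.ne, hxm.ne])
      have := hG.eq_of_even_length hxm hpath hq (by simp) hqe
        (by simp only [Walk.length_cons] at hqk hq4 ⊢; simp; omega)
      have := congrArg Walk.length this
      simp at this hq4
      omega
    obtain ⟨a, b, hab, hl, hae, hbe⟩ := hU.exists_even_split hG hk hke h.symm hxm hem hadj
    have hab' := Walk.isPath_append_iff.mp hab
    have := hG.eq_of_even_length hxm hab'.2.1 hq hbe hqe (by omega)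
    have h1 := hab'.2.2 e (by simp) (by simp [this])
    exact h.ne h1.symm

/-- A walk from `x` to a non-neighbour has to leave the closed neighbourhood of `x`. -/
lemma exists_adj_adj_not_adj {u y x : V} (p : G.Walk u y) (hu : x = u ∨ G.Adj x u) (hxy : x ≠ y)
    (hadj : ¬ G.Adj x y) : ∃ m z, G.Adj x m ∧ G.Adj m z ∧ x ≠ z ∧ ¬ G.Adj x z := by
  induction p with
  | nil => exact (hu.elim hxy hadj).elim
  | @cons a b c h p ih =>
    by_cases hb : x = b ∨ G.Adj x b
    · exact ih hb hxy hadj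
    · rw [not_or] at hb
      rcases hu with rfl | hu
      · exact absurd h hb.2
      · exact ⟨a, b, hu, h, hb.1, hb.2⟩

lemma false_of_even (hU : G.HasUniquePaths k) (hG : G.EvenCycleFree (2 * k)) (hk : 5 ≤ k)
    (hke : Even k) {x y : V} (hne : x ≠ y) (hxy : ¬ G.Adj x y) : False := by
  obtain ⟨p, -, -⟩ := hU.exists_path x y hne hxy
  obtain ⟨m, z, hxm, hmz, hxz, hadj⟩ := exists_adj_adj_not_adj p (Or.inl rfl) hne hxy
  obtain ⟨a, b, hab, hl, hae, hbe⟩ := hU.exists_even_split hG (by omega) hke hxm hmz hxz hadj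
  have hab' := Walk.isPath_append_iff.mp hab
  have ha : a.length ≠ 0 := fun h => hxm.ne (Walk.length_eq_zero_iff.mp h).eq
  have hb : b.length ≠ 0 := fun h => hmz.ne (Walk.length_eq_zero_iff.mp h).eq
  have ha2 := Nat.even_iff.mp hae
  have hb2 := Nat.even_iff.mp hbe
  have hk2 := Nat.even_iff.mp hke
  -- Both pieces have length at least 2 and `k ≥ 6`, so one of them has length between 4 and `k -
  -- 2`.
  by_cases h4 : 4 ≤ a.length
  · exact hU.false_of_four_le hG (by omega) hke hxm a hab'.1 hae h4 (by omega)
  · exact hU.false_of_four_le hG (by omega) hke hmz.symm b.reverse hab'.2.1.reverse (by simpa)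
      (by simp; omega) (by simp; omega)

end EvenLength

section OddLength

/-- If `k` is odd, then the path of length `k` joining the ends of a path `a b c d` contains
an even path between `a` and `b`, between `b` and `c`, or between `c` and `d`. -/
lemma exists_even_subwalk (hG : G.EvenCycleFree (2 * k)) (hk : 5 ≤ k)
    (hko : Odd k) {a b c d : V} (hab : G.Adj a b) (hbc : G.Adj b c) (hcd : G.Adj c d) (hac : a ≠ c)
    (hbd : b ≠ d) (had : a ≠ d) {P : G.Walk a d} (hP : P.IsPath) (hl : P.length = k) :
    (∃ (Y : G.Walk a b) (Z : G.Walk b d), P = Y.append Z ∧ Even Y.length) ∨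
    (∃ (X : G.Walk a b) (Y : G.Walk b c) (Z : G.Walk c d), P = X.append (Y.append Z) ∧
      Even Y.length) ∨
    (∃ (X : G.Walk a c) (Y : G.Walk c d), P = X.append Y ∧ Even Y.length) := by
  have hko' := Nat.odd_iff.mp hko
  by_cases hb : b ∈ P.support
  · obtain ⟨A, D, rfl⟩ := P.mem_support_iff_exists_append.mp hb
    have hAD := Walk.isPath_append_iff.mp hP
    rw [Walk.length_append] at hl
    rcases hG.even_or_eq_one hab hAD.1 (by omega) with hA | hA
    · exact Or.inl ⟨A, D, rfl, hA⟩
    by_cases hc : c ∈ D.support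
    · obtain ⟨B, C, rfl⟩ := D.mem_support_iff_exists_append.mp hc
      have hBC := Walk.isPath_append_iff.mp hAD.2.1
      rw [Walk.length_append] at hl
      rcases hG.even_or_eq_one hbc hBC.1 (by omega) with hB | hB
      · exact Or.inr (Or.inl ⟨A, B, C, rfl, hB⟩)
      rcases hG.even_or_eq_one hcd hBC.2.1 (by omega) with hC | hC
      · exact Or.inr (Or.inr ⟨A.append B, C, (Walk.append_assoc _ _ _), hC⟩)
      omega
    · exfalso
      have hpath : (Walk.cons hbc hcd.toWalk).IsPath :=
        hcd.isPath_toWalk.cons (by simp [Adj.toWalk, hbc.ne, hbd])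
      refine hG.not_even_add hAD.2.1 hpath ?_ (by simp) (by simp; omega)
        (by rw [Nat.even_iff]; simp; omega)
      intro z hz hz'
      simp [Adj.toWalk] at hz'
      rcases hz' with h | rfl | h
      · exact Or.inl h
      · exact absurd hz hc
      · exact Or.inr h
  · by_cases hc : c ∈ P.support
    · obtain ⟨A, C, rfl⟩ := P.mem_support_iff_exists_append.mp hc
      have hAC := Walk.isPath_append_iff.mp hP
      rw [Walk.length_append] at hl
      rcases hG.even_or_eq_one hcd hAC.2.1 (by omega) with hC | hC
      · exact Or.inr (Or.inr ⟨A, C, rfl, hC⟩)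
      exfalso
      have hpath : (Walk.cons hab hbc.toWalk).IsPath :=
        hbc.isPath_toWalk.cons (by simp [Adj.toWalk, hab.ne, hac])
      refine hG.not_even_add hAC.1 hpath ?_ (by simp) (by simp; omega)
        (by rw [Nat.even_iff]; simp; omega)
      intro z hz hz'
      simp [Adj.toWalk] at hz'
      rcases hz' with h | rfl | h
      · exact Or.inl h
      · exact absurd (by simp [hz]) hb
      · exact Or.inr h
    · exfalso
      have hpath : (Walk.cons hab (Walk.cons hbc hcd.toWalk)).IsPath :=
        (hcd.isPath_toWalk.cons (by simp [Adj.toWalk, hbc.ne, hbd])).cons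
          (by simp [Adj.toWalk, hab.ne, hac, had])
      refine hG.not_even_add hP hpath ?_ (by simp) (by simp; omega)
        (by rw [Nat.even_iff]; simp; omega)
      intro z hz hz'
      simp [Adj.toWalk] at hz'
      rcases hz' with h | rfl | rfl | h
      · exact Or.inl h
      · exact absurd hz hb
      · exact absurd hz hc
      · exact Or.inr h

/-- An edge between the ends would create a 4-cycle. -/
lemma exists_path_of_three_path (hU : G.HasUniquePaths k) (hG : G.EvenCycleFree (2 * k))
    (hk : 5 ≤ k) {a b c d : V} (hab : G.Adj a b) (hbc : G.Adj b c) (hcd : G.Adj c d) (hac : a ≠ c)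
    (hbd : b ≠ d) (had : a ≠ d) : ∃ P : G.Walk a d, P.IsPath ∧ P.length = k := by
  refine hU.exists_path a d had fun hadj => ?_
  have hpath : (Walk.cons hab (Walk.cons hbc hcd.toWalk)).IsPath :=
    (hcd.isPath_toWalk.cons (by simp [Adj.toWalk, hbc.ne, hbd])).cons
      (by simp [Adj.toWalk, hab.ne, hac, had])
  refine hG.not_even_add hpath hadj.isPath_toWalk ?_ (by simp) (by simp; omega)
    (by rw [Nat.even_iff]; simp)
  intro z _ hz
  simpa [Adj.toWalk] using hz

/-- On a longer odd cycle take consecutive vertices `u b c d`. The `k`-path from `u` to `d` contains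
an even path between the ends of one of these three edges. By uniqueness that is the complementary
arc of the cycle; it passes through both `u` and `d`, so the `k`-path repeats a vertex. -/
lemma length_le_two_of_even (hU : G.HasUniquePaths k) (hG : G.EvenCycleFree (2 * k))
    (hk : 5 ≤ k) (hko : Odd k) {u w : V} (huw : G.Adj u w) {Q : G.Walk u w} (hQ : Q.IsPath)
    (hQe : Even Q.length) (hQk : Q.length ≤ k) : Q.length ≤ 2 := by
  by_contra hlen
  have hQe' := Nat.even_iff.mp hQe
  have hko' := Nat.odd_iff.mp hko
  cases Q with
  | nil => simp at hlen
  | @cons _ b _ hab Q =>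
  cases Q with
  | nil => simp at hlen
  | @cons _ c _ hbc Q =>
  cases Q with
  | nil => simp at hlen
  | @cons _ d _ hcd Q =>
  simp only [Walk.length_cons] at hQe' hlen hQk
  have hne : d ≠ w := by
    rintro rfl
    have hQ' := hQ.of_cons.of_cons.of_cons
    have := Walk.length_eq_zero_iff.mpr (Walk.isPath_iff_nil.mp hQ')
    omega
  have hcopy := hQ
  simp only [Walk.cons_isPath_iff, Walk.support_cons, List.mem_cons, not_or] at hQ
  obtain ⟨⟨⟨hQ, hcQ⟩, hbc', hbQ⟩, hub, huc, huQ⟩ := hQ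
  have hud : u ≠ d := fun h => huQ (by rw [h]; simp)
  have hbd : b ≠ d := fun h => hbQ (by rw [h]; simp)
  obtain ⟨P, hP, hPl⟩ := hU.exists_path_of_three_path hG hk hab hbc hcd huc hbd hud
  have hr : (Walk.cons huw Q.reverse).IsPath := hQ.reverse.cons (by simpa using huQ)
  have hr1 : (Walk.cons hab.symm (Walk.cons huw Q.reverse)).IsPath :=
    hr.cons (by simpa using ⟨Ne.symm hub, hbQ⟩)
  rcases exists_even_subwalk hG hk hko hab hbc hcd huc hbd hud hP hPl with
    ⟨Y, Z, rfl, hY⟩ | ⟨X, Y, Z, rfl, hY⟩ | ⟨X, Y, rfl, hY⟩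
  · have hYZ := Walk.isPath_append_iff.mp hP
    rw [Walk.length_append] at hPl
    have hC : ((Walk.cons huw Q.reverse).append (hcd.symm.toWalk.append hbc.symm.toWalk)).IsPath := by
      refine Walk.isPath_append_iff.mpr ⟨hr, ?_, ?_⟩
      · refine Walk.isPath_append_iff.mpr ⟨hcd.symm.isPath_toWalk, hbc.symm.isPath_toWalk, ?_⟩
        simp [Adj.toWalk, hbd.symm]
      · intro z hz hz'
        simp only [Adj.toWalk, Walk.support_cons, Walk.support_nil, Walk.support_reverse,
          List.mem_cons, List.mem_reverse, Walk.mem_support_append_iff, List.not_mem_nil,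
          or_false] at hz hz'
        rcases hz' with (h | rfl) | rfl | rfl
        · exact h
        · exact absurd hz (not_or.mpr ⟨Ne.symm huc, hcQ⟩)
        · exact absurd hz (not_or.mpr ⟨Ne.symm huc, hcQ⟩)
        · exact absurd hz (not_or.mpr ⟨Ne.symm hub, hbQ⟩)
    have := hG.eq_of_even_length hab hYZ.1 hC hY
      (by rw [Nat.even_iff]; simp; omega) (by simp; omega)
    have h1 := hYZ.2.2 d (by rw [this]; simp) (by simp)
    exact hbd h1.symm
  · have hYZ := Walk.isPath_append_iff.mp hP
    rw [Walk.length_append, Walk.length_append] at hPl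
    have hC : ((Walk.cons hab.symm (Walk.cons huw Q.reverse)).append hcd.symm.toWalk).IsPath := by
      refine Walk.isPath_append_iff.mpr ⟨hr1, hcd.symm.isPath_toWalk, ?_⟩
      intro z hz hz'
      simp [Adj.toWalk] at hz hz'
      rcases hz' with h | rfl
      · exact h
      · rcases hz with h | h | h
        · exact absurd h.symm hbc'
        · exact absurd h.symm huc
        · exact absurd h hcQ
    have := hG.eq_of_even_length hbc (Walk.isPath_append_iff.mp hYZ.2.1).1 hC hY
      (by rw [Nat.even_iff]; simp; omega) (by simp; omega)
    have h1 := hYZ.2.2 u (by simp) (by rw [this]; simp)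
    exact hub h1
  · have hYZ := Walk.isPath_append_iff.mp hP
    rw [Walk.length_append] at hPl
    have hC : (Walk.cons hbc.symm (Walk.cons hab.symm (Walk.cons huw Q.reverse))).IsPath :=
      hr1.cons (by simpa using ⟨Ne.symm hbc', Ne.symm huc, hcQ⟩)
    have := hG.eq_of_even_length hcd hYZ.2.1 hC hY
      (by rw [Nat.even_iff]; simp; omega) (by simp; omega)
    have h1 := hYZ.2.2 u (by simp) (by rw [this]; simp)
    exact huc h1

/-- A triangle admits no pendant edge: apply `exists_even_subwalk` to `w z x y` and use that short
odd cycles are triangles. -/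
lemma false_of_triangle (hU : G.HasUniquePaths k) (hG : G.EvenCycleFree (2 * k)) (hk : 5 ≤ k)
    (hko : Odd k) {x y z w : V} (hzx : G.Adj z x) (hxy : G.Adj x y) (hyz : G.Adj y z)
    (hwz : G.Adj w z) (hwx : w ≠ x) (hwy : w ≠ y) : False := by
  have hko' := Nat.odd_iff.mp hko
  obtain ⟨P, hP, hPl⟩ := hU.exists_path_of_three_path hG hk hwz hzx hxy hwx hyz.ne.symm hwy
  rcases exists_even_subwalk hG hk hko hwz hzx hxy hwx hyz.ne.symm hwy hP hPl with
    ⟨Y, Z, rfl, hY⟩ | ⟨X, Y, Z, rfl, hY⟩ | ⟨X, Y, rfl, hY⟩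
  · have hYZ := Walk.isPath_append_iff.mp hP
    rw [Walk.length_append] at hPl
    have h2 := hU.length_le_two_of_even hG hk hko hwz hYZ.1 hY (by omega)
    rw [Nat.even_iff] at hY
    rcases hG.even_or_eq_one hyz.symm hYZ.2.1 (by omega) with h1 | h1
    · rw [Nat.even_iff] at h1
      omega
    · omega
  · have hYZ := Walk.isPath_append_iff.mp hP
    have hYZ' := Walk.isPath_append_iff.mp hYZ.2.1
    rw [Walk.length_append, Walk.length_append] at hPl
    have hC : (Walk.cons hyz.symm hxy.symm.toWalk).IsPath :=
      hxy.symm.isPath_toWalk.cons (by simp [Adj.toWalk, hyz.ne.symm, hzx.ne])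
    have := hG.eq_of_even_length hzx hYZ'.1 hC hY (by simp) (by simp; omega)
    have h1 := hYZ'.2.2 y (by rw [this]; simp) (by simp)
    exact hxy.ne h1.symm
  · have hYZ := Walk.isPath_append_iff.mp hP
    rw [Walk.length_append] at hPl
    have hC : (Walk.cons hzx.symm hyz.symm.toWalk).IsPath :=
      hyz.symm.isPath_toWalk.cons (by simp [Adj.toWalk, hzx.ne.symm, hxy.ne])
    have := hG.eq_of_even_length hxy hYZ.2.1 hC hY (by simp) (by simp; omega)
    subst this
    simp at hPl
    have hzX : z ∉ X.support := fun hz => hzx.ne (hYZ.2.2 z hz (by simp))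
    -- The `k`-path ends with `x z y`, so its initial part preceded by `z` is an even path of length
    -- `k - 1` between the adjacent `z` and `x`.
    have hpath : (Walk.cons hwz.symm X).IsPath := hYZ.1.cons hzX
    have := hU.length_le_two_of_even hG hk hko hzx hpath
      (by rw [Nat.even_iff]; simp; omega) (by simp; omega)
    simp at this
    omega

lemma false_of_odd (hU : G.HasUniquePaths k) (hG : G.EvenCycleFree (2 * k)) (hk : 5 ≤ k)
    (hko : Odd k) {a y : V} (hne : a ≠ y) (hay : ¬ G.Adj a y) : False := by
  obtain ⟨p, hp, hpl⟩ := hU.exists_path a y hne hay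
  cases p with
  | nil => simp at hpl; omega
  | @cons _ b _ hab p =>
  cases p with
  | nil => simp at hpl; omega
  | @cons _ c _ hbc p =>
  cases p with
  | nil => simp at hpl; omega
  | @cons _ d _ hcd p =>
  clear hpl hne hay
  simp only [Walk.cons_isPath_iff, Walk.support_cons, List.mem_cons, not_or] at hp
  obtain ⟨⟨⟨-, hcp⟩, hbc', hbp⟩, hab', hac, hap⟩ := hp
  have had : a ≠ d := fun h => hap (by rw [h]; simp)
  have hbd : b ≠ d := fun h => hbp (by rw [h]; simp)
  clear hcp hbp hap
  obtain ⟨P, hP, hPl⟩ := hU.exists_path_of_three_path hG hk hab hbc hcd hac hbd had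
  have hko' := Nat.odd_iff.mp hko
  have apex : ∀ {u w : V} (huw : G.Adj u w) (Y : G.Walk u w), Y.IsPath → Even Y.length →
      Y.length ≤ k → ∃ v, G.Adj u v ∧ G.Adj v w := by
    intro u w huw Y hY hYe hYk
    have h2 := hU.length_le_two_of_even hG hk hko huw hY hYe hYk
    cases Y with
    | nil => exact absurd rfl huw.ne
    | @cons _ v _ h1 Y =>
    cases Y with
    | nil => simp at hYe
    | @cons _ v' _ h1' Y =>
    cases Y with
    | nil => exact ⟨v, h1, h1'⟩
    | cons _ _ => simp at h2
  -- Some edge of `a b c d` lies in a triangle, and a neighbouring edge is pendant to it. If the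
  -- third vertex of the triangle is itself on the path, another edge serves as the pendant one.
  rcases exists_even_subwalk hG hk hko hab hbc hcd hac hbd had hP hPl with
    ⟨Y, Z, rfl, hY⟩ | ⟨X, Y, Z, rfl, hY⟩ | ⟨X, Y, rfl, hY⟩
  · have hYZ := Walk.isPath_append_iff.mp hP
    rw [Walk.length_append] at hPl
    obtain ⟨v, hav, hvb⟩ := apex hab Y hYZ.1 hY (by omega)
    by_cases hvc : v = c
    · subst hvc
      exact hU.false_of_triangle hG hk hko hav.symm hab hbc hcd.symm (Ne.symm had) (Ne.symm hbd)
    · exact hU.false_of_triangle hG hk hko hab.symm hav hvb hbc.symm (Ne.symm hac) (Ne.symm hvc)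
  · have hYZ := Walk.isPath_append_iff.mp hP
    rw [Walk.length_append, Walk.length_append] at hPl
    obtain ⟨v, hbv, hvc⟩ := apex hbc Y (Walk.isPath_append_iff.mp hYZ.2.1).1 hY (by omega)
    by_cases hva : v = a
    · subst hva
      exact hU.false_of_triangle hG hk hko hvc.symm hab hbc hcd.symm (Ne.symm had) (Ne.symm hbd)
    · exact hU.false_of_triangle hG hk hko hbc hvc.symm hbv.symm hab hac (Ne.symm hva)
  · have hYZ := Walk.isPath_append_iff.mp hP
    rw [Walk.length_append] at hPl
    obtain ⟨v, hcv, hvd⟩ := apex hcd Y hYZ.2.1 hY (by omega)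
    by_cases hvb : v = b
    · subst hvb
      exact hU.false_of_triangle hG hk hko hbc hcd hvd.symm hab hac had
    · exact hU.false_of_triangle hG hk hko hcd hvd.symm hcv.symm hbc hbd (Ne.symm hvb)

end OddLength

lemma not_evenCycleFree (hU : G.HasUniquePaths k) (hk : 5 ≤ k) {x y : V} (hne : x ≠ y)
    (hxy : ¬ G.Adj x y) : ¬ G.EvenCycleFree (2 * k) := fun hG =>
  (Nat.even_or_odd k).elim (fun h => hU.false_of_even hG hk h hne hxy)
    (fun h => hU.false_of_odd hG hk h hne hxy)

end HasUniquePaths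

end SimpleGraph

/-! ### Twin copies and their symmetries -/

namespace SimpleGraph

/-- A family, indexed by `ι`, of pairwise disjoint and pairwise non-adjacent induced copies of `H`
in `G` whose corresponding vertices have the same neighbours outside of the copies. -/
structure TwinFamily {V W : Type*} (G : SimpleGraph V) (H : SimpleGraph W) (ι : Type*) where
  φ : ι → W → V
  inj : ∀ i j u w, φ i u = φ j w → i = j ∧ u = w
  adj_iff : ∀ i j u w, G.Adj (φ i u) (φ j w) ↔ i = j ∧ H.Adj u w
  adj_out : ∀ i j w z, (∀ l v, φ l v ≠ z) → G.Adj (φ i w) z → G.Adj (φ j w) z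

namespace TwinFamily

variable {V W ι : Type*} {G : SimpleGraph V} {H : SimpleGraph W} (τ : TwinFamily G H ι)

/-- Vertices that lie in none of the copies. -/
def Out (z : V) : Prop := ∀ l v, τ.φ l v ≠ z

/-- The inclusion of a copy. -/
def hom (i : ι) : H →g G where
  toFun := τ.φ i
  map_rel' h := (τ.adj_iff _ _ _ _).mpr ⟨rfl, h⟩

lemma hom_injective (i : ι) : Function.Injective (τ.hom i) := fun u w h => (τ.inj i i u w h).2

/-- The copy of a walk of `H`. -/
def copyWalk (i : ι) {w u : W} (p : H.Walk w u) : G.Walk (τ.φ i w) (τ.φ i u) := p.map (τ.hom i)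

@[simp] lemma length_copyWalk (i : ι) {w u : W} (p : H.Walk w u) :
    (τ.copyWalk i p).length = p.length := Walk.length_map _ _

@[simp] lemma support_copyWalk (i : ι) {w u : W} (p : H.Walk w u) :
    (τ.copyWalk i p).support = p.support.map (τ.φ i) := Walk.support_map _ _

lemma isPath_copyWalk_iff (i : ι) {w u : W} {p : H.Walk w u} :
    (τ.copyWalk i p).IsPath ↔ p.IsPath := Walk.isPath_map_iff_of_injective (τ.hom_injective i)

lemma out_of_adj {i : ι} {w : W} {z : V} (h : G.Adj (τ.φ i w) z) (hz : ∀ v, τ.φ i v ≠ z) :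
    τ.Out z := by
  rintro l v rfl
  obtain ⟨rfl, -⟩ := (τ.adj_iff _ _ _ _).mp h
  exact hz v rfl

section Perm

open Classical in
/-- The permutation of the vertices induced by a permutation of the copies. -/
noncomputable def perm (π : Equiv.Perm ι) : Equiv.Perm V :=
  Equiv.Perm.extendDomain (π.prodCongr (Equiv.refl W))
    (Equiv.ofInjective (fun p : ι × W => τ.φ p.1 p.2) (fun p q h => by
      obtain ⟨h1, h2⟩ := τ.inj _ _ _ _ h
      exact Prod.ext h1 h2))

lemma perm_apply (π : Equiv.Perm ι) (i : ι) (w : W) : τ.perm π (τ.φ i w) = τ.φ (π i) w := by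
  classical
  exact Equiv.Perm.extendDomain_apply_image (π.prodCongr (Equiv.refl W))
    (Equiv.ofInjective (fun p : ι × W => τ.φ p.1 p.2) (fun p q h => by
      obtain ⟨h1, h2⟩ := τ.inj _ _ _ _ h
      exact Prod.ext h1 h2)) (i, w)

lemma perm_apply_out (π : Equiv.Perm ι) {z : V} (hz : τ.Out z) : τ.perm π z = z := by
  classical
  refine Equiv.Perm.extendDomain_apply_not_subtype _ _ ?_
  rintro ⟨p, rfl⟩
  exact hz _ _ rfl

lemma eq_or_out (z : V) : (∃ i w, τ.φ i w = z) ∨ τ.Out z := by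
  by_cases h : ∃ i w, τ.φ i w = z
  · exact Or.inl h
  · push Not at h
    exact Or.inr h

/-- The endomorphism of the graph induced by a permutation of the copies. -/
noncomputable def permHom (π : Equiv.Perm ι) : G →g G where
  toFun := τ.perm π
  map_rel' {a b} h := by
    rcases τ.eq_or_out a with ⟨i, u, rfl⟩ | ha <;> rcases τ.eq_or_out b with ⟨j, w, rfl⟩ | hb
    · rw [perm_apply, perm_apply, adj_iff] at *
      exact ⟨by rw [h.1], h.2⟩
    · rw [perm_apply, perm_apply_out _ _ hb]
      exact τ.adj_out _ _ _ _ hb h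
    · rw [perm_apply, perm_apply_out _ _ ha]
      exact (τ.adj_out _ _ _ _ ha h.symm).symm
    · rw [perm_apply_out _ _ ha, perm_apply_out _ _ hb]
      exact h

lemma permHom_apply (π : Equiv.Perm ι) (i : ι) (w : W) :
    τ.permHom π (τ.φ i w) = τ.φ (π i) w := τ.perm_apply π i w

lemma permHom_apply_out (π : Equiv.Perm ι) {z : V} (hz : τ.Out z) : τ.permHom π z = z :=
  τ.perm_apply_out π hz

lemma permHom_injective (π : Equiv.Perm ι) : Function.Injective (τ.permHom π) :=
  (τ.perm π).injective

lemma permHom_swap_apply [DecidableEq ι] {i j : ι} {z : V} (hi : ∀ v, τ.φ i v ≠ z)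
    (hj : ∀ v, τ.φ j v ≠ z) : τ.permHom (Equiv.swap i j) z = z := by
  rcases τ.eq_or_out z with ⟨l, w, rfl⟩ | hz
  · rw [permHom_apply, Equiv.swap_apply_of_ne_of_ne]
    · rintro rfl; exact hi w rfl
    · rintro rfl; exact hj w rfl
  · exact τ.permHom_apply_out _ hz

end Perm

/-- A walk that starts in a copy either stays there or has a first vertex outside of the copy. -/
lemma stays_or_leaves (i : ι) {y : V} : ∀ (n : ℕ) (w : W) (P : G.Walk (τ.φ i w) y), P.length = n →
    (∃ (u : W) (p : H.Walk w u), τ.φ i u = y ∧ P.support = p.support.map (τ.φ i)) ∨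
    (∃ (u : W) (p : H.Walk w u) (s : V) (h : G.Adj (τ.φ i u) s) (Q : G.Walk s y), τ.Out s ∧
      P = (τ.copyWalk i p).append (Walk.cons h Q)) := by
  intro n
  induction n with
  | zero =>
    intro w P hP
    have := (Walk.length_eq_zero_iff.mp hP).eq
    subst this
    refine Or.inl ⟨w, .nil, rfl, ?_⟩
    rw [(Walk.length_eq_zero_iff.mp hP).eq_nil]
    simp
  | succ n ih =>
    intro w P hP
    cases P with
    | nil => simp at hP
    | @cons _ b _ h P =>
      by_cases hb : ∃ v, τ.φ i v = b
      · obtain ⟨v, rfl⟩ := hb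
        have hH := ((τ.adj_iff _ _ _ _).mp h).2
        rcases ih v P (by simpa using hP) with ⟨u, p, hu, hp⟩ | ⟨u, p, s, h', Q, hs, rfl⟩
        · exact Or.inl ⟨u, .cons hH p, hu, by simp [hp]⟩
        · exact Or.inr ⟨u, .cons hH p, s, h', Q, hs, rfl⟩
      · push Not at hb
        exact Or.inr ⟨w, .nil, b, h, P, τ.out_of_adj h hb, rfl⟩

/-- `w` is attached to the outside vertex `s`. -/
def Att (w : W) (s : V) : Prop := τ.Out s ∧ ∀ i, G.Adj (τ.φ i w) s

lemma att_of_adj {i : ι} {w : W} {s : V} (hs : τ.Out s) (h : G.Adj (τ.φ i w) s) : τ.Att w s :=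
  ⟨hs, fun j => τ.adj_out i j w s hs h⟩

/-- There is a path of length `n` from `w` to the outside vertex `s` inside a copy. -/
def Exit (w : W) (s : V) (n : ℕ) : Prop :=
  ∃ (u : W) (p : H.Walk w u), p.IsPath ∧ p.length + 1 = n ∧ τ.Att u s

lemma exists_exit_of_isPath {i : ι} {w : W} {y : V} {P : G.Walk (τ.φ i w) y} (hP : P.IsPath)
    (hy : ∀ v, τ.φ i v ≠ y) :
    ∃ (u : W) (p : H.Walk w u) (s : V) (h : G.Adj (τ.φ i u) s) (Q : G.Walk s y), p.IsPath ∧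
      τ.Att u s ∧ P = (τ.copyWalk i p).append (Walk.cons h Q) := by
  rcases τ.stays_or_leaves i _ w P rfl with ⟨u, -, hu, -⟩ | ⟨u, p, s, h, Q, hs, rfl⟩
  · exact absurd hu (hy u)
  · exact ⟨u, p, s, h, Q, (τ.isPath_copyWalk_iff i).mp (Walk.isPath_append_iff.mp hP).1, τ.att_of_adj hs h, rfl⟩

/-- The path that follows `p` in the copy `i` and ends in the outside vertex `s`. -/
def exitWalk (i : ι) {w u : W} (p : H.Walk w u) {s : V} (hs : τ.Att u s) : G.Walk (τ.φ i w) s :=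
  (τ.copyWalk i p).concat (hs.2 i)

lemma length_exitWalk (i : ι) {w u : W} (p : H.Walk w u) {s : V} (hs : τ.Att u s) :
    (τ.exitWalk i p hs).length = p.length + 1 := by
  rw [exitWalk, Walk.length_concat, length_copyWalk]

lemma support_exitWalk (i : ι) {w u : W} (p : H.Walk w u) {s : V} (hs : τ.Att u s) :
    (τ.exitWalk i p hs).support = p.support.map (τ.φ i) ++ [s] := by
  rw [exitWalk, Walk.support_concat, support_copyWalk]

lemma isPath_exitWalk (i : ι) {w u : W} {p : H.Walk w u} (hp : p.IsPath) {s : V}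
    (hs : τ.Att u s) : (τ.exitWalk i p hs).IsPath := by
  refine Walk.IsPath.concat ((τ.isPath_copyWalk_iff i).mpr hp) ?_ _
  rw [support_copyWalk, List.mem_map]
  rintro ⟨v, -, hv⟩
  exact hs.1 i v hv

lemma mem_support_exitWalk {i : ι} {w u : W} {p : H.Walk w u} {s : V} {hs : τ.Att u s} {z : V}
    (hz : z ∈ (τ.exitWalk i p hs).support) : z = s ∨ ∃ v, τ.φ i v = z := by
  rw [support_exitWalk, List.mem_append, List.mem_map, List.mem_singleton] at hz
  rcases hz with ⟨v, -, hv⟩ | hz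
  · exact Or.inr ⟨v, hv⟩
  · exact Or.inl hz

/-- There is a path of length `n` that ends in `s` and is otherwise contained in the copy `i`. -/
def Approach (i : ι) (s : V) (n : ℕ) : Prop :=
  ∃ (x : V) (A : G.Walk x s), A.IsPath ∧ A.length = n ∧
    ∀ z ∈ A.support, z = s ∨ ∃ v, τ.φ i v = z

lemma approach_zero (i : ι) (s : V) : τ.Approach i s 0 := ⟨s, .nil, by simp, by simp, by simp⟩

variable {τ}

lemma Exit.approach {w : W} {s : V} {n m : ℕ} (h : τ.Exit w s n) (hm : m ≤ n) (i : ι) :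
    τ.Approach i s m := by
  obtain ⟨u, p, hp, hl, hs⟩ := h
  refine ⟨_, (τ.exitWalk i p hs).drop (n - m), (τ.isPath_exitWalk i hp hs).drop _, ?_, ?_⟩
  · rw [Walk.drop_length, length_exitWalk]; omega
  · intro z hz
    exact τ.mem_support_exitWalk ((τ.exitWalk i p hs).isSubwalk_drop _ |>.support_subset hz)

lemma Exit.pos {w : W} {s : V} {n : ℕ} (h : τ.Exit w s n) : 1 ≤ n := by
  obtain ⟨u, p, -, hl, -⟩ := h
  omega

section UniquePaths

variable [Fintype ι] {k : ℕ} (hU : G.HasUniquePaths k) (hι : k + 4 ≤ Fintype.card ι)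

-- Swapping copies that contain neither end fixes the path. A visit to one such copy would be a
-- visit to all of them.
include hU hι in
lemma notMem_support {x y : V} {P : G.Walk x y} (hP : P.IsPath) (hl : P.length = k) {i : ι}
    (hx : ∀ v, τ.φ i v ≠ x) (hy : ∀ v, τ.φ i v ≠ y) (w : W) : τ.φ i w ∉ P.support := by
  classical
  intro hw
  have hmem : ∀ j, (∀ v, τ.φ j v ≠ x) → (∀ v, τ.φ j v ≠ y) → τ.φ j w ∈ P.support := by
    intro j hjx hjy
    have h1 := τ.permHom_swap_apply hx hjx
    have h2 := τ.permHom_swap_apply hy hjy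
    have h3 := hU.eq_of_isPath x y
      ((P.map (τ.permHom (Equiv.swap i j))).copy h1 h2) P
      (by simpa using hP.map (τ.permHom_injective _)) hP (by simpa using hl) hl
    rw [← h3, Walk.support_copy, Walk.support_map, List.mem_map]
    exact ⟨_, hw, by rw [permHom_apply, Equiv.swap_apply_left]⟩
  have hone : ∀ z : V, (Finset.univ.filter fun j => ∃ v, τ.φ j v = z).card ≤ 1 := by
    intro z
    rw [Finset.card_le_one]
    simp only [Finset.mem_filter, Finset.mem_univ, true_and]
    rintro a ⟨v, rfl⟩ b ⟨v', h⟩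
    exact (τ.inj _ _ _ _ h).1.symm
  set J := Finset.univ.filter fun j : ι => (∀ v, τ.φ j v ≠ x) ∧ ∀ v, τ.φ j v ≠ y with hJ
  -- A `k`-path has `k + 1` vertices, and at most two copies contain an end; hence `k + 4` copies
  -- are too many.
  have hJcard : J.card ≤ k + 1 := by
    have h1 : (J.image fun j => τ.φ j w) ⊆ P.support.toFinset := by
      intro z hz
      rw [Finset.mem_image] at hz
      obtain ⟨j, hj, rfl⟩ := hz
      rw [hJ, Finset.mem_filter] at hj
      simpa using hmem j hj.2.1 hj.2.2
    have h2 := Finset.card_le_card h1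
    rw [Finset.card_image_of_injective _ (fun a b h => (τ.inj _ _ _ _ h).1)] at h2
    have h3 := P.support.toFinset_card_le
    rw [Walk.length_support] at h3
    omega
  have hcover : (Finset.univ : Finset ι) ⊆ J ∪ ((Finset.univ.filter fun j => ∃ v, τ.φ j v = x) ∪
      (Finset.univ.filter fun j => ∃ v, τ.φ j v = y)) := by
    intro j _
    simp only [hJ, Finset.mem_union, Finset.mem_filter, Finset.mem_univ, true_and]
    by_cases h1 : ∃ v, τ.φ j v = x
    · tauto
    by_cases h2 : ∃ v, τ.φ j v = y
    · tauto
    push Not at h1 h2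
    tauto
  have h1 := Finset.card_le_card hcover
  have h2 := Finset.card_union_le J ((Finset.univ.filter fun j => ∃ v, τ.φ j v = x) ∪
      (Finset.univ.filter fun j => ∃ v, τ.φ j v = y))
  have h3 := Finset.card_union_le (Finset.univ.filter fun j => ∃ v, τ.φ j v = x)
      (Finset.univ.filter fun j => ∃ v, τ.φ j v = y)
  have h4 := hone x
  have h5 := hone y
  rw [Finset.card_univ] at h1
  omega

end UniquePaths

end TwinFamily

end SimpleGraph

/-! ### How copies are attached to the outside -/

namespace SimpleGraph

namespace TwinFamily

variable {V W ι : Type*} {G : SimpleGraph V} {H : SimpleGraph W} {τ : TwinFamily G H ι} {k : ℕ}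

lemma ne_and_not_adj {i j : ι} (hij : i ≠ j) (u w : W) :
    τ.φ i u ≠ τ.φ j w ∧ ¬ G.Adj (τ.φ i u) (τ.φ j w) :=
  ⟨fun h => hij (τ.inj _ _ _ _ h).1, fun h => hij ((τ.adj_iff _ _ _ _).mp h).1⟩

section Exits

variable (hU : G.HasUniquePaths k)

include hU in
/-- The path joining two corresponding vertices is symmetric, so its middle vertex lies outside of
the copies. -/
lemma exists_exit_half {i j : ι} (hij : i ≠ j) (w : W) : ∃ r s, k = 2 * r ∧ τ.Exit w s r := by
  classical
  obtain ⟨P, hP, hl⟩ := hU.exists_path _ _ (ne_and_not_adj (τ := τ) hij w w).1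
    (ne_and_not_adj hij w w).2
  obtain ⟨u, p, s, h, Q, hp, hs, hPeq⟩ := τ.exists_exit_of_isPath hP
    (fun v hv => hij (τ.inj _ _ _ _ hv).1)
  refine ⟨p.length + 1, s, ?_, u, p, hp, rfl, hs⟩
  have e1 : τ.permHom (Equiv.swap i j) (τ.φ i w) = τ.φ j w := by
    rw [permHom_apply, Equiv.swap_apply_left]
  have e2 : τ.permHom (Equiv.swap i j) (τ.φ j w) = τ.φ i w := by
    rw [permHom_apply, Equiv.swap_apply_right]
  -- The swap exchanges the ends, so the reversed image has the ends of `P`. As `s` is fixed, it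
  -- stands at mirrored positions of `P`.
  have h1 : ((P.map (τ.permHom (Equiv.swap i j))).copy e1 e2).reverse = P :=
    hU.eq_of_isPath _ _ _ _
      (by rw [Walk.isPath_reverse_iff, Walk.isPath_copy]; exact hP.map (τ.permHom_injective _)) hP
      (by simpa using hl) hl
  have hlen := congrArg Walk.length hPeq
  simp only [Walk.length_append, length_copyWalk, Walk.length_cons] at hlen
  have hm : P.getVert (p.length + 1) = s := by
    rw [hPeq, Walk.getVert_append]
    simp
  have h2 : P.getVert (k - (p.length + 1)) = s := by
    rw [← h1, Walk.getVert_reverse]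
    simp only [Walk.length_copy, Walk.length_map, Walk.getVert_copy, Walk.getVert_map]
    rw [hl, Nat.sub_sub_self (by omega), hm, τ.permHom_apply_out _ hs.1]
  have := hP.getVert_injOn (by simp; omega) (by simp; omega) (h2.trans hm.symm)
  omega

/-- Joining a path in one copy to a path in another copy. -/
lemma isPath_exitWalk_append {i j : ι} (hij : i ≠ j) {w u w' u' : W} {p : H.Walk w u}
    {q : H.Walk w' u'} (hp : p.IsPath) (hq : q.IsPath) {s : V} (hs : τ.Att u s) (hs' : τ.Att u' s) :
    ((τ.exitWalk i p hs).append (τ.exitWalk j q hs').reverse).IsPath := by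
  refine Walk.isPath_append_iff.mpr ⟨τ.isPath_exitWalk i hp hs,
    (τ.isPath_exitWalk j hq hs').reverse, fun z hz hz' => ?_⟩
  rw [Walk.support_reverse, List.mem_reverse] at hz'
  rcases τ.mem_support_exitWalk hz with h | ⟨v, h⟩
  · exact h
  rcases τ.mem_support_exitWalk hz' with h' | ⟨v', h'⟩
  · exact h'
  exact absurd (τ.inj _ _ _ _ (h.trans h'.symm)).1 hij

include hU in
lemma support_eq_of_exit {i j : ι} (hij : i ≠ j) {w u₁ u₂ w' u₃ u₄ : W} {p₁ : H.Walk w u₁}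
    {p₂ : H.Walk w u₂} {q₁ : H.Walk w' u₃} {q₂ : H.Walk w' u₄} (hp₁ : p₁.IsPath) (hp₂ : p₂.IsPath)
    (hq₁ : q₁.IsPath) (hq₂ : q₂.IsPath) {s : V} (hs₁ : τ.Att u₁ s) (hs₂ : τ.Att u₂ s)
    (hs₃ : τ.Att u₃ s) (hs₄ : τ.Att u₄ s) (h₁ : p₁.length + q₁.length + 2 = k)
    (h₂ : p₂.length + q₂.length + 2 = k) : p₁.support = p₂.support := by
  have heq := hU.eq_of_isPath _ _ _ _ (isPath_exitWalk_append hij hp₁ hq₁ hs₁ hs₃)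
    (isPath_exitWalk_append hij hp₂ hq₂ hs₂ hs₄) (by simp [length_exitWalk]; omega)
    (by simp [length_exitWalk]; omega)
  have g₁ : ((τ.exitWalk i p₁ hs₁).append (τ.exitWalk j q₁ hs₃).reverse).getVert
      (p₁.length + 1) = s := by
    rw [Walk.getVert_append]
    simp [length_exitWalk]
  have g₂ : ((τ.exitWalk i p₁ hs₁).append (τ.exitWalk j q₁ hs₃).reverse).getVert
      (p₂.length + 1) = s := by
    rw [heq, Walk.getVert_append]
    simp [length_exitWalk]
  have hlen := (isPath_exitWalk_append hij hp₁ hq₁ hs₁ hs₃).getVert_injOn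
    (by simp [length_exitWalk]) (by simp [length_exitWalk]; omega) (g₁.trans g₂.symm)
  have hsup := congrArg Walk.support heq
  rw [Walk.support_append, Walk.support_append] at hsup
  have hsup' := (List.append_inj hsup
    (by rw [Walk.length_support, Walk.length_support, length_exitWalk, length_exitWalk]; omega)).1
  rw [support_exitWalk, support_exitWalk] at hsup'
  have := List.append_cancel_right hsup'
  exact (List.map_injective_iff.mpr fun a b h => (τ.inj i i a b h).2) this

include hU in
/-- Two exits to the same vertex whose lengths add up to `k` both have length `k / 2`. -/
lemma exit_length_eq {i j : ι} (hij : i ≠ j) {r a b : ℕ} (hr : k = 2 * r) {s : V} {w w' : W}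
    (hw : τ.Exit w s r) (hw' : τ.Exit w' s r) (ha : τ.Exit w s a) (hb : τ.Exit w' s b)
    (hab : a + b = k) : a = r := by
  obtain ⟨u₁, p₁, hp₁, hl₁, hs₁⟩ := ha
  obtain ⟨u₂, p₂, hp₂, hl₂, hs₂⟩ := hw
  obtain ⟨u₃, p₃, hp₃, hl₃, hs₃⟩ := hb
  obtain ⟨u₄, p₄, hp₄, hl₄, hs₄⟩ := hw'
  have := support_eq_of_exit hU hij hp₁ hp₂ hp₃ hp₄ hs₁ hs₂ hs₃ hs₄ (by omega) (by omega)
  have := congrArg List.length this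
  rw [Walk.length_support, Walk.length_support] at this
  omega

end Exits

section Detours

variable [Fintype ι] (hU : G.HasUniquePaths k) (hι : k + 4 ≤ Fintype.card ι)

-- The path comes from copy `i` to `s`, passes through copy `l` to `s'` and ends in copy `j`; thus a
-- `k`-path would visit a copy containing neither end.
include hU hι in
lemma false_of_detour {i j l : ι} (hij : i ≠ j) (hil : i ≠ l) (hjl : j ≠ l) {s s' : V}
    (hne : s ≠ s') {u u' : W} {p : H.Walk u u'} (hp : p.IsPath) (hs : τ.Att u s)
    (hs' : τ.Att u' s') {m n : ℕ} (hm : τ.Approach i s m) (hn : τ.Approach j s' n)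
    (hk : m + (p.length + 2) + n = k) : False := by
  obtain ⟨x, A, hA, hAl, hAs⟩ := hm
  obtain ⟨y, B, hB, hBl, hBs⟩ := hn
  have hD : (Walk.cons (hs.2 l).symm (τ.exitWalk l p hs')).IsPath := by
    refine (τ.isPath_exitWalk l hp hs').cons fun h => ?_
    rcases τ.mem_support_exitWalk h with h | ⟨v, h⟩
    · exact hne h
    · exact hs.1 l v h
  have hDB : ((Walk.cons (hs.2 l).symm (τ.exitWalk l p hs')).append B.reverse).IsPath := by
    refine Walk.isPath_append_iff.mpr ⟨hD, hB.reverse, fun z hz hz' => ?_⟩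
    rw [Walk.support_reverse, List.mem_reverse] at hz'
    rw [Walk.support_cons, List.mem_cons] at hz
    rcases hBs z hz' with h | ⟨v, rfl⟩
    · exact h
    rcases hz with h | hz
    · exact absurd h (hs.1 j v)
    rcases τ.mem_support_exitWalk hz with h | ⟨v', h⟩
    · exact h
    · exact absurd (τ.inj _ _ _ _ h).1 (Ne.symm hjl)
  have hP : (A.append ((Walk.cons (hs.2 l).symm (τ.exitWalk l p hs')).append B.reverse)).IsPath := by
    refine Walk.isPath_append_iff.mpr ⟨hA, hDB, fun z hz hz' => ?_⟩
    rcases hAs z hz with h | ⟨v, rfl⟩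
    · exact h
    rw [Walk.mem_support_append_iff, Walk.support_cons, List.mem_cons, Walk.support_reverse,
      List.mem_reverse] at hz'
    rcases hz' with (h | h) | h
    · exact h
    · rcases τ.mem_support_exitWalk h with h | ⟨v', h⟩
      · exact absurd h (hs'.1 i v)
      · exact absurd (τ.inj _ _ _ _ h).1 (Ne.symm hil)
    · rcases hBs _ h with h | ⟨v', h⟩
      · exact absurd h (hs'.1 i v)
      · exact absurd (τ.inj _ _ _ _ h).1 (Ne.symm hij)
  refine notMem_support hU hι (τ := τ) (i := l) hP ?_ ?_ ?_ u ?_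
  · simp only [Walk.length_append, Walk.length_cons, length_exitWalk, Walk.length_reverse]
    omega
  · rintro v rfl
    rcases hAs _ A.start_mem_support with h | ⟨v', h⟩
    · exact hs.1 l v h
    · exact hil (τ.inj _ _ _ _ h).1
  · rintro v rfl
    rcases hBs _ B.start_mem_support with h | ⟨v', h⟩
    · exact hs'.1 l v h
    · exact hjl (τ.inj _ _ _ _ h).1
  · simp

variable {i j l : ι} (hij : i ≠ j) (hil : i ≠ l) (hjl : j ≠ l) {r : ℕ} (hr : k = 2 * r)

include hU hι hij hil hjl hr in
lemma eq_of_att_of_exit {w : W} {s s' : V} (hs : τ.Att w s) (hs' : τ.Exit w s' r) : s = s' := by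
  by_contra hne
  have h0 := hs'.pos
  obtain ⟨u, p, hp, hl, hu⟩ := hs'
  rcases Nat.lt_or_ge r 2 with h2 | h2
  · have hm : τ.Approach i s 0 := τ.approach_zero i s
    exact false_of_detour hU hι hij hil hjl hne hp hs hu hm (τ.approach_zero j s') (by omega)
  -- Running back along `p` to `w` gives an approach of length `r - 1` to `s`; the detour to `s'`
  -- has length `r + 1`, and the total is `k`.
  have hex : τ.Exit (p.getVert (r - 2)) s (r - 1) :=
    ⟨w, (p.take (r - 2)).reverse, (hp.take _).reverse, by
      rw [Walk.length_reverse, Walk.take_length]; omega, hs⟩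
  exact false_of_detour hU hι hij hil hjl hne hp hs hu (hex.approach le_rfl i)
    (τ.approach_zero j s') (by omega)

include hU hι hij hil hjl hr in
lemma exit_of_att {w : W} {s : V} (hs : τ.Att w s) : τ.Exit w s r := by
  obtain ⟨r', s', hr', h⟩ := exists_exit_half hU hij w
  obtain rfl : r = r' := by omega
  rwa [eq_of_att_of_exit hU hι hij hil hjl hr hs h]

include hU hι hij hil hjl hr in
/-- Exits from vertices that are close to each other end in the same vertex. -/
lemma eq_of_exit_of_exit {w w' : W} {s s' : V} {a b : ℕ} (hs : τ.Exit w s a) (hs' : τ.Exit w' s' b)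
    (q : H.Walk w w') (hk : a + q.length + b ≤ k) : s = s' := by
  classical
  by_contra hne
  obtain ⟨u, p, hp, hl, hu⟩ := hs
  obtain ⟨u', p', hp', hl', hu'⟩ := hs'
  have hex := exit_of_att hU hι hij hil hjl hr hu
  have hex' := exit_of_att hU hι hij hil hjl hr hu'
  obtain ⟨D, hD, hlen⟩ : ∃ D : H.Walk u u', D.IsPath ∧
      D.length ≤ p.length + (q.length + p'.length) :=
    ⟨_, (p.reverse.append (q.append p')).bypass_isPath,
      (Walk.length_bypass_le_length _).trans (by simp)⟩
  -- The detour along `D` has length at most `k`. Approaches of length up to `r` on either side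
  -- supply any missing length up to `2r = k`.
  by_cases hm : k - D.length - 2 ≤ r
  · exact false_of_detour hU hι hij hil hjl hne hD hu hu' (hex.approach hm i)
      (τ.approach_zero j s') (by omega)
  · exact false_of_detour hU hι hij hil hjl hne hD hu hu'
      (hex.approach le_rfl i) (hex'.approach (m := k - D.length - 2 - r) (by omega) j) (by omega)

-- Compare the first and the last outside vertex of the `k`-path joining the two copies.
omit [Fintype ι] in
include hU hij in
lemma exists_exits (z z' : W) :
    (∃ s a b, τ.Exit z s a ∧ τ.Exit z' s b ∧ a + b = k) ∨
    (∃ s s' a b, s ≠ s' ∧ τ.Exit z s a ∧ τ.Exit z' s' b ∧ a + 1 + b ≤ k) := by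
  obtain ⟨P, hP, hl⟩ := hU.exists_path _ _ (ne_and_not_adj (τ := τ) hij z z').1
    (ne_and_not_adj hij z z').2
  obtain ⟨u, p, s, h, Q, hp, hs, hPeq⟩ := τ.exists_exit_of_isPath hP
    (fun v hv => hij (τ.inj _ _ _ _ hv).1)
  obtain ⟨u', p', s', h', Q', hp', hs', hPeq'⟩ := τ.exists_exit_of_isPath hP.reverse
    (fun v hv => hij (τ.inj _ _ _ _ hv).1.symm)
  have hlen := congrArg Walk.length hPeq
  have hlen' := congrArg Walk.length hPeq'
  simp only [Walk.length_append, length_copyWalk, Walk.length_cons, Walk.length_reverse]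
    at hlen hlen'
  have g : P.getVert (p.length + 1) = s := by
    rw [hPeq, Walk.getVert_append]
    simp
  have g' : P.getVert (k - (p'.length + 1)) = s' := by
    have : P.reverse.getVert (p'.length + 1) = s' := by
      rw [hPeq', Walk.getVert_append]
      simp
    rwa [Walk.getVert_reverse, hl] at this
  have hle : p.length + 1 ≤ k - (p'.length + 1) := by
    by_contra hcon
    have h1 : P.getVert (k - (p'.length + 1)) ∈ (τ.copyWalk i p).support := by
      rw [hPeq, Walk.getVert_append]
      split_ifs with h2
      · exact Walk.getVert_mem_support _ _
      · rw [length_copyWalk] at h2 ⊢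
        rw [show k - (p'.length + 1) - p.length = 0 by omega, Walk.getVert_zero]
        exact Walk.end_mem_support _
    rw [g', support_copyWalk, List.mem_map] at h1
    obtain ⟨v, -, hv⟩ := h1
    exact hs'.1 i v hv
  by_cases hss : s = s'
  · subst hss
    refine Or.inl ⟨s, p.length + 1, p'.length + 1, ⟨u, p, hp, rfl, hs⟩, ⟨u', p', hp', rfl, hs'⟩, ?_⟩
    have := hP.getVert_injOn (by simp; omega) (by simp; omega) (g.trans g'.symm)
    omega
  · refine Or.inr ⟨s, s', p.length + 1, p'.length + 1, hss, ⟨u, p, hp, rfl, hs⟩,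
      ⟨u', p', hp', rfl, hs'⟩, ?_⟩
    rcases hle.lt_or_eq with h1 | h1
    · omega
    · exact absurd (by rw [← g, ← g', h1]) hss

include hU hι hij hil hjl hr in
lemma eq_of_adj_of_exit {z z' : W} (hzz' : H.Adj z z') {s s' : V} (hs : τ.Exit z s r)
    (hs' : τ.Exit z' s' r) : s = s' := by
  rcases exists_exits hU hij (τ := τ) z z' with
    ⟨t, a, b, ha, hb, hab⟩ | ⟨t, t', a, b, hne, ha, hb, hab⟩
  · rcases Nat.lt_trichotomy a r with h | h | h
    · have h1 := eq_of_exit_of_exit hU hι hij hil hjl hr ha hs .nil (by simp; omega)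
      have h2 := eq_of_exit_of_exit hU hι hij hil hjl hr ha hs' hzz'.toWalk (by simp; omega)
      exact h1.symm.trans h2
    · have h1 := eq_of_exit_of_exit hU hι hij hil hjl hr ha hs .nil (by simp; omega)
      have h2 := eq_of_exit_of_exit hU hι hij hil hjl hr hb hs' .nil (by simp; omega)
      exact h1.symm.trans h2
    · have h1 := eq_of_exit_of_exit hU hι hij hil hjl hr hb hs' .nil (by simp; omega)
      have h2 := eq_of_exit_of_exit hU hι hij hil hjl hr hb hs hzz'.symm.toWalk (by simp; omega)
      exact h2.symm.trans h1
  · exact absurd (eq_of_exit_of_exit hU hι hij hil hjl hr ha hb hzz'.toWalk (by simpa using hab)) hne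

include hU hι hij hil hjl hr in
/-- All copies are attached to a single outside vertex. -/
lemma exists_unique_attachment [Nonempty W] (hH : H.Preconnected) :
    ∃ s, τ.Out s ∧ (∀ w, τ.Exit w s r) ∧ ∀ w t, τ.Att w t → t = s := by
  obtain ⟨w₀⟩ := ‹Nonempty W›
  have hex : ∀ w, ∃ s, τ.Exit w s r := by
    intro w
    obtain ⟨r', s, hr', h⟩ := exists_exit_half hU hij w
    obtain rfl : r = r' := by omega
    exact ⟨s, h⟩
  obtain ⟨s, hs⟩ := hex w₀
  have hall : ∀ w, τ.Exit w s r := by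
    intro w
    obtain ⟨p⟩ := hH w w₀
    induction p with
    | nil => exact hs
    | @cons a b c h p ih =>
      obtain ⟨t, ht⟩ := hex a
      rwa [← eq_of_adj_of_exit hU hι hij hil hjl hr h ht (ih hs)]
  refine ⟨s, ?_, hall, fun w t ht => eq_of_att_of_exit hU hι hij hil hjl hr ht (hall w)⟩
  obtain ⟨u, p, -, -, hu⟩ := hs
  exact hu.1

end Detours

/-! ### Copies attached to a single outside vertex -/

section SingleAttachment

variable (hU : G.HasUniquePaths k) {i j : ι} (hij : i ≠ j) {r : ℕ} (hr : k = 2 * r) {s : V}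
  (hex : ∀ w, τ.Exit w s r) (hatt : ∀ w t, τ.Att w t → t = s)

include hatt in
lemma exit_of_isPath {w : W} (hs : τ.Out s) {P : G.Walk (τ.φ i w) s} (hP : P.IsPath) :
    ∃ (u : W) (p : H.Walk w u), p.IsPath ∧ p.length + 1 = P.length ∧ τ.Att u s ∧
      P.support = p.support.map (τ.φ i) ++ [s] := by
  obtain ⟨u, p, t, h, Q, hp, ht, rfl⟩ := τ.exists_exit_of_isPath hP (fun v => hs i v)
  obtain rfl := hatt _ _ ht
  have hQ := (Walk.isPath_append_iff.mp hP).2.1.of_cons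
  obtain rfl : Q = .nil := (Walk.isPath_iff_nil.mp hQ).eq_nil
  exact ⟨u, p, hp, by simp, ht, by simp [Walk.support_append]⟩

-- Otherwise a `k`-path from `w` to `s` runs inside the copy. Without its first edge it is an exit
-- of length `k - 1`, and its last vertex in the copy has an exit of length 1; these add up to `k`
-- without being equal.
include hU hij hr hex hatt in
lemma att_of_unique_attachment (hr2 : 2 ≤ r) (hs : τ.Out s) (w : W) : τ.Att w s := by
  by_contra hw
  have hadj : ¬ G.Adj (τ.φ i w) s := fun h => hw (τ.att_of_adj hs h)
  obtain ⟨P, hP, hl⟩ := hU.exists_path _ _ (hs i w) hadj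
  obtain ⟨u, p, hp, hpl, hu, -⟩ := exit_of_isPath hatt hs hP
  cases p with
  | nil => simp at hpl; omega
  | @cons _ w₁ _ h p =>
    simp only [Walk.length_cons] at hpl
    have h1 : τ.Exit w₁ s (k - 1) := ⟨u, p, hp.of_cons, by omega, hu⟩
    have h2 : τ.Exit u s 1 := ⟨u, .nil, by simp, by simp, hu⟩
    have := exit_length_eq hU hij hr (hex _) (hex _) h1 h2 (by omega)
    omega

variable (hall : ∀ w, τ.Att w s)

include hU hij hr hall in
lemma support_eq_of_length_eq {w u u' : W} {p : H.Walk w u} {q : H.Walk w u'}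
    (hp : p.IsPath) (hq : q.IsPath) (hpl : p.length + 1 = r) (hql : q.length + 1 = r) :
    p.support = q.support :=
  support_eq_of_exit hU hij hp hq hp hp (hall _) (hall _) (hall _) (hall _) (by omega) (by omega)

-- A longer path would provide exits of lengths `r + 1` and `r - 1`.
include hU hij hr hex hall in
lemma length_lt (hr2 : 2 ≤ r) {w u : W} {p : H.Walk w u} (hp : p.IsPath) : p.length < r := by
  by_contra hcon
  have h1 : τ.Exit w s (r + 1) := ⟨_, p.take r, hp.take _, by
    rw [Walk.take_length]; omega, hall _⟩
  have h2 : τ.Exit w s (r - 1) := ⟨_, p.take (r - 2), hp.take _, by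
    rw [Walk.take_length]; omega, hall _⟩
  have := exit_length_eq hU hij hr (hex _) (hex _) h1 h2 (by omega)
  omega

-- If `x` and `y` were not adjacent, their `k`-path would be too long to stay in the copy, so it
-- passes through `s`, exactly halfway. Its first half then follows `q` and meets `y` prematurely.
include hU hij hr hex hatt hall in
lemma adj_of_mem_support (hr2 : 2 ≤ r) (hs : τ.Out s) {x x' y : W} {q : H.Walk x x'}
    (hq : q.IsPath) (hql : q.length + 1 = r) (hy : y ∈ q.support) (hyx : y ≠ x) : H.Adj x y := by
  by_contra hadj
  obtain ⟨P, hP, hl⟩ := hU.exists_path (τ.φ i x) (τ.φ i y)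
    (fun h => hyx (τ.inj _ _ _ _ h).2.symm) (fun h => hadj ((τ.adj_iff _ _ _ _).mp h).2)
  rcases τ.stays_or_leaves i _ x P rfl with ⟨u, p, hu, hp⟩ | ⟨u, p, t, h, Q, ht, rfl⟩
  · have hpp : p.IsPath := by
      rw [Walk.isPath_def, hp] at hP
      exact (Walk.isPath_def p).mpr hP.of_map
    have h1 := length_lt hU hij hr hex hall hr2 hpp
    have h2 := congrArg List.length hp
    rw [Walk.length_support, List.length_map, Walk.length_support] at h2
    omega
  · obtain rfl := hatt _ _ (τ.att_of_adj ht h)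
    have hP' := Walk.isPath_append_iff.mp hP
    have hp := (τ.isPath_copyWalk_iff i).mp hP'.1
    obtain ⟨u', p', hp', hpl', -, -⟩ := exit_of_isPath hatt hs hP'.2.1.of_cons.reverse
    simp only [Walk.length_append, length_copyWalk, Walk.length_cons, Walk.length_reverse]
      at hl hpl'
    have h1 := exit_length_eq hU hij hr (hex _) (hex _) ⟨u, p, hp, rfl, hall _⟩
      ⟨u', p', hp', rfl, hall _⟩ (by omega)
    have h2 := support_eq_of_length_eq hU hij hr hall hp hq h1 hql
    have h3 := hP'.2.2 (τ.φ i y) (by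
      rw [support_copyWalk]; exact List.mem_map_of_mem (h2 ▸ hy)) (by simp)
    obtain rfl := (τ.inj _ _ _ _ h3).2
    have := Walk.length_eq_zero_iff.mpr (Walk.isPath_iff_nil.mp hP'.2.1)
    simp at this

include hU hij hr hex hatt in
lemma false_of_unique_attachment [Nonempty W] (hr3 : 3 ≤ r) (hs : τ.Out s) : False := by
  have hall := att_of_unique_attachment hU hij hr hex hatt (by omega) hs
  obtain ⟨w₀⟩ := ‹Nonempty W›
  obtain ⟨u, q, hq, hql, -⟩ := hex w₀
  have hadj := fun {x x' y : W} {q : H.Walk x x'} =>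
    adj_of_mem_support hU hij hr hex hatt hall (by omega) hs (q := q) (y := y)
  cases q with
  | nil => simp at hql; omega
  | @cons _ a _ h q =>
  cases q with
  | nil => simp at hql; omega
  | @cons _ b _ h' q =>
  have hq' := hq
  simp only [Walk.cons_isPath_iff, Walk.support_cons, List.mem_cons, not_or] at hq'
  obtain ⟨⟨hqp, haq⟩, hwa, hwq⟩ := hq'
  simp only [Walk.length_cons] at hql
  have hau : a ≠ u := by rintro rfl; exact haq q.end_mem_support
  have hbw : b ≠ w₀ := by rintro rfl; exact hwq q.start_mem_support
  have e1 : H.Adj w₀ b := hadj hq (by simp; omega) (by simp) hbw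
  have e2 : H.Adj u a := hadj hq.reverse (by simp; omega) (by simp) hau
  -- The path `w₀ a b … u` is rerouted as `w₀ b … u a`, with the same start and length.
  have hnew : (Walk.cons e1 (q.concat e2)).IsPath := by
    refine (hqp.concat haq e2).cons ?_
    rw [Walk.support_concat, List.mem_append, List.mem_singleton]
    tauto
  have := support_eq_of_length_eq hU hij hr hall hq hnew (by simp; omega)
    (by simp; omega)
  have hab : a = b := by
    cases q <;> simp at this <;> tauto
  exact h'.ne hab

end SingleAttachment

/-- A graph with unique paths of length `k ≥ 5` does not contain many twin copies of a connected
graph. -/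
lemma false_of_hasUniquePaths [Fintype ι] [Nonempty W] (τ : TwinFamily G H ι)
    (hU : G.HasUniquePaths k) (hk : 5 ≤ k) (hι : k + 4 ≤ Fintype.card ι) (hH : H.Preconnected) :
    False := by
  obtain ⟨i, j, l, hij, hil, hjl⟩ := Fintype.two_lt_card_iff.mp (by omega : 2 < Fintype.card ι)
  obtain ⟨r, -, hr, -⟩ := exists_exit_half (τ := τ) hU hij (Classical.arbitrary W)
  obtain ⟨s, hs, hex, hatt⟩ := exists_unique_attachment (τ := τ) hU hι hij hil hjl hr hH
  exact false_of_unique_attachment hU hij hr hex hatt (by omega) hs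

end TwinFamily

end SimpleGraph

/-! ### Twins in large graphs without long paths -/

namespace SimpleGraph

universe u

section Component

variable {V : Type u} {G : SimpleGraph V} {T : Finset V}

/-- The vertices that can be reached from `b` by walks avoiding `T`. -/
def reachAvoiding (G : SimpleGraph V) (T : Finset V) (b : V) : Set V :=
  {z | ∃ p : G.Walk b z, ∀ w ∈ p.support, w ∉ T}

lemma self_mem_reachAvoiding {b : V} (hb : b ∉ T) : b ∈ G.reachAvoiding T b :=
  ⟨.nil, by simpa using hb⟩

lemma notMem_of_mem_reachAvoiding {b z : V} (hz : z ∈ G.reachAvoiding T b) : z ∉ T := by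
  obtain ⟨p, hp⟩ := hz
  exact hp z p.end_mem_support

lemma mem_reachAvoiding_of_adj {b z z' : V} (hz : z ∈ G.reachAvoiding T b) (h : G.Adj z z')
    (hz' : z' ∉ T) : z' ∈ G.reachAvoiding T b := by
  obtain ⟨p, hp⟩ := hz
  refine ⟨p.concat h, fun w hw => ?_⟩
  rw [Walk.support_concat, List.mem_append, List.mem_singleton] at hw
  rcases hw with hw | rfl
  · exact hp w hw
  · exact hz'

lemma reachAvoiding_eq_of_mem {b z : V} (hz : z ∈ G.reachAvoiding T b) :
    G.reachAvoiding T z = G.reachAvoiding T b := by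
  obtain ⟨p, hp⟩ := hz
  ext y
  constructor
  · rintro ⟨q, hq⟩
    refine ⟨p.append q, fun w hw => ?_⟩
    rw [Walk.mem_support_append_iff] at hw
    exact hw.elim (hp w) (hq w)
  · rintro ⟨q, hq⟩
    refine ⟨p.reverse.append q, fun w hw => ?_⟩
    rw [Walk.mem_support_append_iff, Walk.support_reverse, List.mem_reverse] at hw
    exact hw.elim (hp w) (hq w)

lemma reachAvoiding_eq_of_mem_of_mem {b b' z : V} (hz : z ∈ G.reachAvoiding T b)
    (hz' : z ∈ G.reachAvoiding T b') : G.reachAvoiding T b = G.reachAvoiding T b' :=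
  (reachAvoiding_eq_of_mem hz).symm.trans (reachAvoiding_eq_of_mem hz')

end Component

/-- `G` contains `m` twin copies of some connected graph. -/
def HasTwins {V : Type u} (G : SimpleGraph V) (m : ℕ) : Prop :=
  ∃ (W : Type) (H : SimpleGraph W), Nonempty W ∧ H.Preconnected ∧ Nonempty (TwinFamily G H (Fin m))

/-- The isomorphism types, relative to a set of `t` vertices, of graphs with at most `s` vertices. -/
abbrev TypeCode (s t : ℕ) : Type :=
  Set (Fin s) × (Fin s → Fin s → Prop) × (Fin s → Fin t → Prop)

/-- The isomorphism type over `T` of a set `C` of vertices. -/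
def typeCode {V : Type u} (G : SimpleGraph V) {T : Finset V} {s t : ℕ} (idx : T ↪ Fin t)
    {C : Set V} (g : C ↪ Fin s) : TypeCode s t :=
  (Set.range g, fun a b => ∃ x y : C, g x = a ∧ g y = b ∧ G.Adj x y,
    fun a c => ∃ (x : C) (y : T), g x = a ∧ idx y = c ∧ G.Adj x y)

section TypeCode

variable {V : Type u} {G : SimpleGraph V} {T : Finset V} {s t : ℕ} {idx : T ↪ Fin t}
  {C D : Set V} {g : C ↪ Fin s} {g' : D ↪ Fin s}

lemma adj_of_typeCode_eq (h : typeCode G idx g = typeCode G idx g') {x y : C} {x' y' : D}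
    (hx : g x = g' x') (hy : g y = g' y') (hadj : G.Adj x y) : G.Adj x' y' := by
  have h1 := congrFun (congrFun (congrArg (fun c => c.2.1) h) (g x)) (g y)
  have h2 : ∃ x₁ y₁ : D, g' x₁ = g x ∧ g' y₁ = g y ∧ G.Adj x₁ y₁ := by
    rw [typeCode, typeCode] at h1
    exact h1.mp ⟨x, y, rfl, rfl, hadj⟩
  obtain ⟨x₁, y₁, e1, e2, hadj'⟩ := h2
  rw [hx] at e1
  rw [hy] at e2
  rwa [g'.injective e1, g'.injective e2] at hadj'

lemma adj_of_typeCode_eq' (h : typeCode G idx g = typeCode G idx g') {x : C} {x' : D} {y : T}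
    (hx : g x = g' x') (hadj : G.Adj x y) : G.Adj x' y := by
  have h1 := congrFun (congrFun (congrArg (fun c => c.2.2) h) (g x)) (idx y)
  have h2 : ∃ (x₁ : D) (y₁ : T), g' x₁ = g x ∧ idx y₁ = idx y ∧ G.Adj x₁ y₁ := by
    rw [typeCode, typeCode] at h1
    exact h1.mp ⟨x, y, rfl, rfl, hadj⟩
  obtain ⟨x₁, y₁, e1, e2, hadj'⟩ := h2
  rw [hx] at e1
  rwa [g'.injective e1, idx.injective e2] at hadj'

end TypeCode

/-- Vertices with equal labels correspond. Distinct components are disjoint and non-adjacent, and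
the outside neighbours of a component all lie in `T`, where the codes agree. -/
lemma hasTwins_of_typeCode_eq {V : Type u} {G : SimpleGraph V} {T : Finset V} {s t m : ℕ}
    {idx : T ↪ Fin t} {f : Fin (m + 1) → Set V} (hf : Function.Injective f)
    (hc : ∀ i, ∃ b, b ∉ T ∧ f i = G.reachAvoiding T b) (g : ∀ i, f i ↪ Fin s)
    (hg : ∀ i j, typeCode G idx (g i) = typeCode G idx (g j)) : G.HasTwins (m + 1) := by
  classical
  have hrange : ∀ i, Set.range (g 0) = Set.range (g i) := fun i => congrArg (fun c => c.1) (hg 0 i)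
  have hex : ∀ (i : Fin (m + 1)) (w : Set.range (g 0)), ∃ x : f i, g i x = w := by
    intro i w
    exact (hrange i).subset w.2
  choose φ hφ using hex
  have hsurj : ∀ i (x : f i), ∃ w, φ i w = x := by
    intro i x
    refine ⟨⟨g i x, by rw [hrange i]; exact ⟨x, rfl⟩⟩, (g i).injective ?_⟩
    rw [hφ]
  have hdisj : ∀ i j (z : V), z ∈ f i → z ∈ f j → i = j := by
    intro i j z hi hj
    obtain ⟨b, -, hb⟩ := hc i
    obtain ⟨b', -, hb'⟩ := hc j
    apply hf
    rw [hb] at hi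
    rw [hb'] at hj
    rw [hb, hb', reachAvoiding_eq_of_mem_of_mem hi hj]
  have hclosed : ∀ i (z z' : V), z ∈ f i → G.Adj z z' → z' ∉ T → z' ∈ f i := by
    intro i z z' hz h hz'
    obtain ⟨b, -, hb⟩ := hc i
    rw [hb] at hz ⊢
    exact mem_reachAvoiding_of_adj hz h hz'
  have hnotT : ∀ i (z : V), z ∈ f i → z ∉ T := by
    intro i z hz
    obtain ⟨b, -, hb⟩ := hc i
    rw [hb] at hz
    exact notMem_of_mem_reachAvoiding hz
  have hiff : ∀ i u w, G.Adj (φ i u : V) (φ i w) ↔ G.Adj (φ 0 u : V) (φ 0 w) := fun i u w =>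
    ⟨adj_of_typeCode_eq (hg i 0) (by rw [hφ, hφ]) (by rw [hφ, hφ]),
      adj_of_typeCode_eq (hg 0 i) (by rw [hφ, hφ]) (by rw [hφ, hφ])⟩
  refine ⟨Set.range (g 0), G.comap (fun w => (φ 0 w : V)), ?_, ?_, ⟨⟨fun i w => φ i w, ?_, ?_, ?_⟩⟩⟩
  · obtain ⟨b, hb, hb'⟩ := hc 0
    have : b ∈ f 0 := by rw [hb']; exact self_mem_reachAvoiding hb
    exact ⟨⟨_, ⟨b, this⟩, rfl⟩⟩
  · have key : ∀ {x y : V} (p : G.Walk x y), (∀ w ∈ p.support, w ∉ T) →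
        ∀ a : Set.range (g 0), (φ 0 a : V) = x → ∃ c : Set.range (g 0), (φ 0 c : V) = y ∧
          (G.comap (fun w => (φ 0 w : V))).Reachable a c := by
      intro x y p
      induction p with
      | nil => exact fun _ a ha => ⟨a, ha, .refl _⟩
      | @cons x x' y h p ih =>
        intro hp a ha
        have hx' : x' ∈ f 0 := hclosed 0 x x' (ha ▸ (φ 0 a).2) h (hp x' (by simp))
        obtain ⟨a', ha'⟩ := hsurj 0 ⟨x', hx'⟩
        have ha'' : (φ 0 a' : V) = x' := by rw [ha']
        obtain ⟨c, hc, hr⟩ := ih (fun w hw => hp w (by simp [hw])) a' ha''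
        refine ⟨c, hc, Reachable.trans (Adj.reachable ?_) hr⟩
        simpa [ha, ha''] using h
    intro a c
    obtain ⟨b, -, hb⟩ := hc 0
    have h1 : (φ 0 a : V) ∈ G.reachAvoiding T b := hb ▸ (φ 0 a).2
    have h2 : (φ 0 c : V) ∈ G.reachAvoiding T (φ 0 a) := by
      rw [reachAvoiding_eq_of_mem h1]
      exact hb ▸ (φ 0 c).2
    obtain ⟨p, hp⟩ := h2
    obtain ⟨c', hc', hr⟩ := key p hp a rfl
    have : c' = c := by
      have h3 := congrArg (g 0) (Subtype.ext hc')
      rw [hφ, hφ] at h3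
      exact Subtype.ext h3
    rwa [this] at hr
  · intro i j a c h
    obtain rfl := hdisj i j _ (φ i a).2 (h ▸ (φ j c).2)
    have h3 := congrArg (g i) (Subtype.ext h)
    rw [hφ, hφ] at h3
    exact ⟨rfl, Subtype.ext h3⟩
  · intro i j a c
    constructor
    · intro h
      obtain rfl := hdisj i j _ (hclosed i _ _ (φ i a).2 h (hnotT j _ (φ j c).2)) (φ j c).2
      exact ⟨rfl, (hiff i a c).mp h⟩
    · rintro ⟨rfl, h⟩
      exact (hiff i a c).mpr h
  · intro i j w z hz h
    have hzT : z ∈ T := by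
      by_contra hzT
      obtain ⟨c, hc⟩ := hsurj i ⟨z, hclosed i _ _ (φ i w).2 h hzT⟩
      exact hz i c (by rw [hc])
    exact adj_of_typeCode_eq' (hg i j) (y := ⟨z, hzT⟩) (by rw [hφ, hφ]) h

lemma exists_hasTwins_of_ncard_le (s t m : ℕ) : ∃ N : ℕ, ∀ (V : Type u) [Finite V]
    (G : SimpleGraph V) (T : Finset V) (B : Set V), T.card ≤ t → (∀ b ∈ B, b ∉ T) →
    (∀ b ∈ B, (G.reachAvoiding T b).ncard ≤ s) → N ≤ (⋃ b ∈ B, G.reachAvoiding T b).ncard →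
    G.HasTwins (m + 1) := by
  classical
  -- Components of size at most `s` covering this many vertices number more than `m + 1` per type.
  refine ⟨Nat.card (TypeCode s t) * (m + 1) * s + 1, ?_⟩
  intro V _ G T B hT hB hs hN
  have := Fintype.ofFinite V
  have := Fintype.ofFinite (TypeCode s t)
  set 𝒞 : Finset (Set V) := ((Set.toFinite B).toFinset).image (G.reachAvoiding T) with h𝒞
  have hmem : ∀ C ∈ 𝒞, ∃ b ∈ B, G.reachAvoiding T b = C := by
    intro C hC
    simpa [h𝒞] using hC
  have hcard : (⋃ b ∈ B, G.reachAvoiding T b).ncard ≤ 𝒞.card * s := by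
    have h1 : (⋃ b ∈ B, G.reachAvoiding T b) =
        ((𝒞.biUnion fun C => (Set.toFinite C).toFinset : Finset V) : Set V) := by
      ext z
      simp [h𝒞]
    rw [h1, Set.ncard_coe_finset]
    refine Finset.card_biUnion_le_card_mul _ _ _ fun C hC => ?_
    obtain ⟨b, hb, rfl⟩ := hmem C hC
    rw [← Set.ncard_eq_toFinset_card]
    exact hs b hb
  obtain ⟨idx⟩ : Nonempty (T ↪ Fin t) :=
    Function.Embedding.nonempty_of_card_le (by simpa using hT)
  have hg : ∀ C : Set V, C ∈ 𝒞 → Nonempty (C ↪ Fin s) := by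
    intro C hC
    obtain ⟨b, hb, rfl⟩ := hmem C hC
    refine Function.Embedding.nonempty_of_card_le ?_
    rw [Fintype.card_fin, ← Nat.card_eq_fintype_card]
    exact hs b hb
  let code : Set V → TypeCode s t := fun C =>
    if h : C ∈ 𝒞 then typeCode G idx (hg C h).some else (∅, fun _ _ => False, fun _ _ => False)
  have hcode : ∀ C (h : C ∈ 𝒞), code C = typeCode G idx (hg C h).some := fun C h => dif_pos h
  have hlt : (Finset.univ : Finset (TypeCode s t)).card * (m + 1) < 𝒞.card := by
    rw [Finset.card_univ, ← Nat.card_eq_fintype_card]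
    by_contra hcon
    have := Nat.mul_le_mul_right s (not_lt.mp hcon)
    omega
  obtain ⟨y, -, hy⟩ := Finset.exists_lt_card_fiber_of_mul_lt_card_of_maps_to
    (f := code) (fun C _ => Finset.mem_univ (code C)) hlt
  obtain ⟨F, hF, hFcard⟩ := Finset.exists_subset_card_eq hy.le
  let e : Fin (m + 1) ≃ F := (Finset.equivFinOfCardEq hFcard).symm
  have he : ∀ i, (e i : Set V) ∈ 𝒞 ∧ code (e i) = y := fun i => by
    simpa using hF (e i).2
  refine hasTwins_of_typeCode_eq (T := T) (idx := idx) (f := fun i => (e i : Set V))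
    (fun i j h => e.injective (Subtype.ext h)) ?_ (fun i => (hg _ (he i).1).some) ?_
  · intro i
    obtain ⟨b, hb, hb'⟩ := hmem _ (he i).1
    exact ⟨b, hB b hb, hb'.symm⟩
  · intro i j
    rw [← hcode _ (he i).1, ← hcode _ (he j).1, (he i).2, (he j).2]

/-- A large graph all of whose paths avoiding a small set `T` are short contains many twin copies of
a connected graph. -/
lemma exists_hasTwins_of_length_lt (l m : ℕ) : ∀ t : ℕ, ∃ N : ℕ, ∀ (V : Type u) [Finite V]
    (G : SimpleGraph V) (T : Finset V) (B : Set V), T.card ≤ t → (∀ b ∈ B, b ∉ T) →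
    (∀ b ∈ B, ∀ (z : V) (p : G.Walk b z), p.IsPath → (∀ w ∈ p.support, w ∉ T) → p.length < l) →
    N ≤ (⋃ b ∈ B, G.reachAvoiding T b).ncard → G.HasTwins (m + 1) := by
  classical
  induction l with
  | zero =>
    refine fun t => ⟨1, fun V _ G T B _ hB hl hN => ?_⟩
    obtain rfl : B = ∅ := by
      refine Set.eq_empty_of_forall_notMem fun b hb => ?_
      exact absurd (hl b hb b .nil (by simp) (by simpa using hB b hb)) (by simp)
    simp at hN
  | succ l ih =>
    intro t
    obtain ⟨N₁, hN₁⟩ := ih (t + 1)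
    obtain ⟨N₂, hN₂⟩ := exists_hasTwins_of_ncard_le.{u} N₁ t m
    refine ⟨N₂, fun V _ G T B hT hB hl hN => ?_⟩
    -- If all components are small, pigeonhole applies. In a large one, deleting `b` shortens the
    -- paths that start at neighbours of `b` and still leaves at least `N₁` vertices.
    by_cases hs : ∀ b ∈ B, (G.reachAvoiding T b).ncard ≤ N₁
    · exact hN₂ V G T B hT hB hs hN
    push Not at hs
    obtain ⟨b, hb, hbN⟩ := hs
    refine hN₁ V G (insert b T) {b' | G.Adj b b' ∧ b' ∉ insert b T}
      ((Finset.card_insert_le _ _).trans (by omega)) (fun b' hb' => hb'.2) ?_ ?_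
    · intro b' hb' z p hp hpT
      have h1 := hl b hb z (.cons hb'.1 p)
        (hp.cons fun h => hpT b h (Finset.mem_insert_self _ _)) (by
          intro w hw
          rw [Walk.support_cons, List.mem_cons] at hw
          rcases hw with rfl | hw
          · exact hB _ hb
          · exact fun h => hpT w hw (Finset.mem_insert_of_mem h))
      simpa using h1
    · have hsub : G.reachAvoiding T b ⊆ insert b (⋃ b' ∈ {b' | G.Adj b b' ∧ b' ∉ insert b T},
          G.reachAvoiding (insert b T) b') := by
        rintro z ⟨p, hp⟩
        by_cases hz : z = b
        · exact Set.mem_insert_iff.mpr (Or.inl hz)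
        refine Set.mem_insert_of_mem _ ?_
        have hq := p.bypass_isPath
        have hqT : ∀ w ∈ p.bypass.support, w ∉ T := fun w hw => hp w (p.support_bypass_subset_support hw)
        generalize p.bypass = q at hq hqT
        cases q with
        | nil => exact absurd rfl hz
        | @cons _ b' _ h q =>
          rw [Walk.cons_isPath_iff] at hq
          have hqT' : ∀ w ∈ q.support, w ∉ insert b T := by
            intro w hw hwT
            rcases Finset.mem_insert.mp hwT with rfl | hwT
            · exact hq.2 hw
            · exact hqT w (by simp [hw]) hwT
          exact Set.mem_biUnion (x := b') ⟨h, hqT' b' q.start_mem_support⟩ ⟨q, hqT'⟩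
      have h1 := Set.ncard_le_ncard hsub (Set.toFinite _)
      have h2 := Set.ncard_insert_le b (⋃ b' ∈ {b' | G.Adj b b' ∧ b' ∉ insert b T},
          G.reachAvoiding (insert b T) b')
      omega

/-! ### Paths leaving an even cycle, and the final bound -/

namespace HasUniquePaths

variable {V : Type u} {G : SimpleGraph V} {k : ℕ}

/-- Paths leaving a short even cycle are short. -/
lemma length_lt_of_isCycle (hU : G.HasUniquePaths k) {v : V} {c : G.Walk v v} (hc : c.IsCycle)
    (he : Even c.length) (hck : c.length ≤ 2 * k) {x y : V} (hx : x ∈ c.support) {e : G.Walk x y}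
    (hpath : e.IsPath) (hce : ∀ z ∈ e.support, z ∈ c.support → z = x) : e.length < k := by
  classical
  by_contra hlen
  obtain ⟨a, ha⟩ := he
  have hc3 := hc.three_le_length
  have hc' := hc.rotate hx
  have hl : (c.rotate x hx).length = c.length := Walk.length_rotate _ _ _
  have hs : ∀ z ∈ (c.rotate x hx).support, z ∈ c.support := fun z hz =>
    (Walk.mem_support_rotate_iff _ _ _).mp hz
  generalize c.rotate x hx = d at hc' hl hs
  have hp : (d.take a).IsPath := hc'.isPath_take (by omega)
  have hq : (d.drop a).IsPath := hc'.isPath_drop (by omega)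
  have hee : (e.take (k - a)).IsPath := hpath.take _
  have hes : ∀ z ∈ (e.take (k - a)).support, z ∈ d.support → z = x := fun z hz hz' =>
    hce z ((e.isSubwalk_take _).support_subset hz) (hs z hz')
  have h1 : ((d.take a).reverse.append (e.take (k - a))).IsPath :=
    Walk.isPath_append_iff.mpr ⟨hp.reverse, hee, fun z hz hz' => hes z hz'
      ((d.isSubwalk_take a).support_subset (by simpa using hz))⟩
  have h2 : ((d.drop a).append (e.take (k - a))).IsPath :=
    Walk.isPath_append_iff.mpr ⟨hq, hee, fun z hz hz' => hes z hz'
      ((d.isSubwalk_drop a).support_subset hz)⟩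
  have heq := hU.eq_of_isPath _ _ _ _ h1 h2
    (by rw [Walk.length_append, Walk.length_reverse, Walk.take_length, Walk.take_length]; omega)
    (by rw [Walk.length_append, Walk.drop_length, Walk.take_length]; omega)
  -- Just before reaching `x`, the two paths are at the two neighbours of `x` on the cycle.
  have hv := congrArg (fun w => w.getVert (a - 1)) heq
  simp only [Walk.getVert_append, Walk.length_reverse, Walk.take_length, Walk.drop_length,
    Walk.getVert_reverse, Walk.take_getVert, Walk.drop_getVert] at hv
  rw [if_pos (by omega), if_pos (by omega)] at hv
  have := hc'.getVert_injOn (by simp; omega) (by simp; omega) hv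
  omega

lemma reachable (hU : G.HasUniquePaths k) (x y : V) : G.Reachable x y := by
  by_cases hxy : x = y
  · exact hxy ▸ .refl _
  by_cases h : G.Adj x y
  · exact h.reachable
  · exact (hU.exists_path x y hxy h).choose.reachable

end HasUniquePaths

lemma exists_forall_card_lt_of_hasUniquePaths (k : ℕ) (hk : 5 ≤ k) : ∃ N : ℕ, ∀ (V : Type u)
    [Finite V] (G : SimpleGraph V), G.HasUniquePaths k → (∃ x y, x ≠ y ∧ ¬ G.Adj x y) →
    Nat.card V < N := by
  classical
  -- `k + 3` stands for `k + 4` twins; `2 * k + 1` bounds the length of the support list of the even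
  -- cycle.
  obtain ⟨N, hN⟩ := exists_hasTwins_of_length_lt.{u} k (k + 3) (2 * k + 1)
  refine ⟨N + (2 * k + 1), fun V _ G hU ⟨x, y, hne, hxy⟩ => ?_⟩
  by_contra hcard
  have hE := hU.not_evenCycleFree hk hne hxy
  rw [EvenCycleFree] at hE
  push Not at hE
  obtain ⟨v, c, hc, he, hck⟩ := hE
  have hTcard : c.support.toFinset.card ≤ 2 * k + 1 := by
    have := c.support.toFinset_card_le
    rw [Walk.length_support] at this
    omega
  have hmemT : ∀ z, z ∈ c.support.toFinset ↔ z ∈ c.support := fun z => List.mem_toFinset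
  generalize c.support.toFinset = T at hTcard hmemT
  have htwins : G.HasTwins (k + 3 + 1) → False := by
    rintro ⟨W, H, hW, hH, ⟨τ⟩⟩
    exact τ.false_of_hasUniquePaths hU hk (by simp) hH
  refine htwins (hN V G T {b | b ∉ T ∧ ∃ d ∈ T, G.Adj d b} hTcard (fun b hb => hb.1) ?_ ?_)
  · rintro b ⟨hb, d, hd, h⟩ z p hp hpT
    have h1 := hU.length_lt_of_isCycle hc he hck ((hmemT d).mp hd) (e := .cons h p)
      (hp.cons fun h => hpT d h hd) (by
        intro w hw hw'
        rw [Walk.support_cons, List.mem_cons] at hw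
        rcases hw with hw | hw
        · exact hw
        · exact absurd ((hmemT w).mpr hw') (hpT w hw))
    rw [Walk.length_cons] at h1
    omega
  -- The graph is connected, so every vertex off the cycle is in a component containing a neighbour
  -- of the cycle.
  · have hsub : (T : Set V)ᶜ ⊆ ⋃ b ∈ {b | b ∉ T ∧ ∃ d ∈ T, G.Adj d b}, G.reachAvoiding T b := by
      intro z hz
      obtain ⟨p, hp⟩ := (hU.reachable z v).exists_isPath
      obtain ⟨d, q, r, rfl, hd, hq⟩ := p.exists_eq_append_of_end_mem (T : Set V)
        ((hmemT v).mpr c.start_mem_support)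
      have hqp := (Walk.isPath_append_iff.mp hp).1.reverse
      have hqT : ∀ w ∈ q.reverse.support, w ∈ T → w = d := fun w hw hwT =>
        hq w (by simpa using hw) hwT
      generalize q.reverse = q' at hqp hqT
      cases q' with
      | nil => exact absurd hd hz
      | @cons _ b _ h q' =>
        rw [Walk.cons_isPath_iff] at hqp
        have hq'T : ∀ w ∈ q'.support, w ∉ T := fun w hw hwT =>
          hqp.2 ((hqT w (by simp [hw]) hwT) ▸ hw)
        exact Set.mem_biUnion (x := b) ⟨hq'T b q'.start_mem_support, d, hd, h⟩ ⟨q', hq'T⟩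
    have h1 := Set.ncard_le_ncard hsub (Set.toFinite _)
    have h2 := Set.ncard_add_ncard_compl (T : Set V)
    rw [Set.ncard_coe_finset] at h2
    omega

lemma IsUniquelySaturated.exists_not_adj {V : Type u} [Finite V] {G : SimpleGraph V} {t : ℕ}
    (h : (cycleGraph t).IsUniquelySaturated G) (hV : t ≤ Nat.card V) :
    ∃ x y, x ≠ y ∧ ¬ G.Adj x y := by
  by_contra! hcon
  have := Fintype.ofFinite V
  obtain ⟨f⟩ : Nonempty (Fin t ↪ V) := Function.Embedding.nonempty_of_card_le (by
    rwa [Fintype.card_fin, ← Nat.card_eq_fintype_card])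
  exact h.1.1 ⟨⟨⟨f, fun hab => hcon _ _ (f.injective.ne hab.ne)⟩, f.injective⟩⟩

end SimpleGraph

/-- For every `t ≥ 6` there is a finite list of finite graphs such that every finite uniquely
`C_t`-saturated graph is isomorphic to a member of the list. -/
theorem mainTheorem1 (t : ℕ) (ht : 6 ≤ t) :
    ∃ L : Finset (Σ n : ℕ, SimpleGraph (Fin n)),
      ∀ (V : Type*) [Finite V] (G : SimpleGraph V),
        (SimpleGraph.cycleGraph t).IsUniquelySaturated G →
          ∃ H ∈ L, Nonempty (G ≃g H.2) := by
  classical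
  obtain ⟨k, rfl⟩ : ∃ k, t = k + 1 := ⟨t - 1, by omega⟩
  obtain ⟨N, hN⟩ := SimpleGraph.exists_forall_card_lt_of_hasUniquePaths k (by omega)
  refine ⟨(Finset.range (N + k + 1)).sigma fun n => Finset.univ, fun V _ G hG => ?_⟩
  have hlt : Nat.card V < N + k + 1 := by
    by_contra hcon
    have := hN V G (hG.hasUniquePaths (by omega)) (hG.exists_not_adj (by omega))
    omega
  let e := Finite.equivFin V
  exact ⟨⟨Nat.card V, G.map e.toEmbedding⟩, by simpa using hlt, ⟨SimpleGraph.Iso.map e G⟩⟩
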